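/- **Setting.** Let $\mathcal V,\mathcal W$ be finite-dimensional Hilbert spaces over $\mathbb K\in\{\mathbb R,\mathbb C\}$. On operators write $\|X\|_*=\operatorname{Tr}\sqrt{X^\dagger X}$, $\|X\|_F=\sqrt{\operatorname{Tr}(X^\dagger X)}$ and $\|X\|_\infty$ for the nuclear, Frobenius and spectral norms, and for $X\in L(\mathcal W\otimes\mathcal V)$ define the square norm $$\|X\|_\square=\max\{\|(1_{\mathcal W}\otimes A)X(1_{\mathcal W}\otimes B)\|_*:\ A,B\in L(\mathcal V),\ \|A\|_F=\|B\|_F=\sqrt{\dim\mathcal V}\}.$$ Let $\mathcal H$ be a finite-dimensional Hilbert space over $\mathbb K$, $n=\dim\mathcal H$, let $\mathcal L\subseteq L(\mathcal H)$ be a real subspace (the signal space; e.g. all operators, or the Hermitian ones), and let $1\le r\le n$. Let $A_1,\dots,A_m\in L(\mathcal H)$ be independent copies of a random matrix $A$, and let $\mathcal A(X)=(\operatorname{Tr}(A_iX))_{i=1}^m\in\mathbb K^m$ for $X\in\mathcal L$. For $f:L(\mathcal H)\to\mathbb R$ let $\mathrm{DC}(f,X)=\bigcup_{\tau>0}\{U: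 f(X+\tau U)\le f(X)\}$. Let $K_r$ be the set of all $Y\in\mathcal L$ lying in $\mathrm{DC}(\|\cdot\|_*,X)$ for some $0\ne X\in\mathcal L$ of rank at most $r$. Put $E_r=\{Y\in K_r:\|Y\|_F=1\}$, $Q_{\xi}(E_r;A)=\inf_{Y\in E_r}\Pr[|\operatorname{Tr}(AY)|\ge\xi]$ and $H=m^{-1/2}\sum_{j=1}^m\epsilon_jA_j$, where $\epsilon$ is a Rademacher sequence independent of the $A_j$. For $\xi,C_1,C_2>0$ we say that the ensemble *meets the criteria* $(\xi,C_1,C_2)$ if $Q_{2\xi}(E_r;A)\ge C_1$ and $\mathbb E\|H\|_\infty\le C_2\sqrt{m/r}$. We say that minimization of $f$ *stably recovers* a set $S\subseteq\mathcal L$ from $\mathcal A$ with constant $C$ if, simultaneously for all $X_0\in S$, all $\eta\ge0$ and all $\epsilon\in\mathbb K^m$ with Euclidean norm at most $\eta$, the problem $\min\{f(X): X\in\mathcal L,\ \|\mathcal A(X)-y\|_2\le\eta\}$ with $y=\mathcal A(X_0)+\epsilon$ has a solution, and each of its solutions $X_\eta$ obeys $\|X_\eta-X_0\|_F\le \eta/(C\sqrt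 m)$. **Statement.** Let $\xi,C_1,C_2>0$ satisfy $\xi C_1>2(1+\sqrt2)C_2$. There are constants $C_3^*,C_4^*>0$ and $C_3^\square\ge C_3^*$, $C_4^\square\ge C_4^*$, depending only on $\xi,C_1,C_2$, such that the following hold. 1. (Nuclear norm.) For every $\mathcal H$, $\mathcal L$, $r$, $m$ and every ensemble meeting the criteria $(\xi,C_1,C_2)$, with probability at least $1-e^{-C_4^*m}$, minimization of $\|\cdot\|_*$ stably recovers the set of all $X_0\in\mathcal L$ of rank at most $r$ with constant $C_3^*$. 2. (Square norm.) For $\mathcal H=\mathcal W\otimes\mathcal V$, every $\mathcal L$, $r$, $m$ and every ensemble meeting the same criteria, with probability at least $1-e^{-C_4^\square m}$, minimization of $\|\cdot\|_\square$ stably recovers the set of all $X_0\in\mathcal L$ of rank at most $r$ with $\|X_0\|_\square=\|X_0\|_*$ with constant $C_3^\square$. 3. (Any constants certified by the nuclear norm descent cones carry over.) Let $\mathcal H=\mathcal W\otimes\mathcal V$, let $A_1,\dots,A_m$ be arbitrary $L(\mathcal H)$-valued functions on a probability space, and let $K_r^\square$ be the set of all $Y\in\mathcal L$ lying in $\mathrm{DC}(\|\cdot\|_\square,X)$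 for some $0\ne X\in\mathcal L$ of rank at most $r$ with $\|X\|_\square=\|X\|_*$. For a set $K$ put $\lambda_{\min}(\mathcal A;K)=\inf_{0\ne Y\in K}\|\mathcal A(Y)\|_2/\|Y\|_F$. If $c_3,c_4>0$ are such that $\lambda_{\min}(\mathcal A;K_r)\ge 2c_3\sqrt m$ with probability at least $1-e^{-c_4m}$, then with probability at least $1-e^{-c_4m}$ one has $\lambda_{\min}(\mathcal A;K^\square_r)\ge2c_3\sqrt m$, the nuclear norm minimization stably recovers all $X_0\in\mathcal L$ of rank at most $r$ with constant $c_3$, and the square norm minimization stably recovers, with the same constant $c_3$, all such $X_0$ that satisfy $\|X_0\|_\square=\|X_0\|_*$. Here "an assertion holds with probability at least $p$" means that it holds on some measurable event of probability at least $p$. -/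

import Mathlib

open MeasureTheory ProbabilityTheory
open scoped ENNReal Matrix Kronecker

noncomputable section

namespace SquareRecovery

variable {𝕜 : Type*} [RCLike 𝕜]

/-- Matrices carry the Borel σ-algebra of their (entrywise) topology. -/
instance instMeasurableSpaceMatrix {k l : Type*} : MeasurableSpace (Matrix k l 𝕜) := borel _

instance instBorelSpaceMatrix {k l : Type*} : BorelSpace (Matrix k l 𝕜) := ⟨rfl⟩

section Norms

variable {n w v : Type*} [Fintype n] [DecidableEq n] [Fintype w] [DecidableEq w]
  [Fintype v] [DecidableEq v]

/-- Nuclear norm `Tr √(X† X)`; the square root is taken in the functional calculus of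
Hermitian matrices. -/
def nuclearNorm (X : Matrix n n 𝕜) : ℝ := RCLike.re (cfc Real.sqrt (Xᴴ * X)).trace

/-- Frobenius norm `√(Tr (X† X))`. -/
def frobNorm (X : Matrix n n 𝕜) : ℝ := √(RCLike.re (Xᴴ * X).trace)

/-- Spectral norm: the operator norm for the Euclidean norm on `𝕜ⁿ`. -/
def specNorm (X : Matrix n n 𝕜) : ℝ := ‖Matrix.toEuclideanCLM (n := n) (𝕜 := 𝕜) X‖

/-- Square norm of an operator on `W ⊗ V`: the maximum of the nuclear norms of
`(1 ⊗ A) X (1 ⊗ B)` over operators `A`, `B` on `V` of Frobenius norm `√(dim V)`. -/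
def squareNorm (X : Matrix (w × v) (w × v) 𝕜) : ℝ :=
  sSup {t : ℝ | ∃ A B : Matrix v v 𝕜,
    frobNorm A = √(Fintype.card v) ∧ frobNorm B = √(Fintype.card v) ∧
    t = nuclearNorm (((1 : Matrix w w 𝕜) ⊗ₖ A) * X * ((1 : Matrix w w 𝕜) ⊗ₖ B))}

end Norms

section Cones

variable {n : Type*} [Fintype n]

/-- Descent cone of `f` at `X`. -/
def descentCone (f : Matrix n n 𝕜 → ℝ) (X : Matrix n n 𝕜) : Set (Matrix n n 𝕜) :=
  ⋃ τ : ℝ, ⋃ _ : 0 < τ, {U | f (X + τ • U) ≤ f X}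

/-- Union of the descent cones, inside the signal space `L`, of `f` anchored at the nonzero
elements of `L` that lie in `S`. -/
def coneUnion (f : Matrix n n 𝕜 → ℝ) (L : Submodule ℝ (Matrix n n 𝕜))
    (S : Set (Matrix n n 𝕜)) : Set (Matrix n n 𝕜) :=
  {U | U ∈ L ∧ ∃ X ∈ L, X ∈ S ∧ X ≠ 0 ∧ U ∈ descentCone f X}

/-- Matrices of rank at most `r`. -/
def rankLE (r : ℕ) : Set (Matrix n n 𝕜) := {X | X.rank ≤ r}

/-- Bipartite matrices of rank at most `r` whose square norm equals their nuclear norm. -/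
def rankLEExtremal {w v : Type*} [Fintype w] [DecidableEq w] [Fintype v] [DecidableEq v]
    (r : ℕ) : Set (Matrix (w × v) (w × v) 𝕜) :=
  {X | X.rank ≤ r ∧ squareNorm X = nuclearNorm X}

end Cones

section Measurements

variable {n : Type*} [Fintype n] {m : ℕ}

/-- The measurement map `X ↦ (Tr (A₁ X), …, Tr (Aₘ X))`, with Euclidean norm on its values. -/
def measurementMap (A : Fin m → Matrix n n 𝕜) (X : Matrix n n 𝕜) : EuclideanSpace 𝕜 (Fin m) :=
  WithLp.toLp 2 fun i => (A i * X).trace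

/-- Minimum singular value of the measurement map with respect to the cone `K`: the infimum of
`‖𝒜 Y‖ / ‖Y‖` over nonzero `Y ∈ K` (`∞` if there is none). -/
def minConicSV (A : Fin m → Matrix n n 𝕜) (K : Set (Matrix n n 𝕜)) : ℝ≥0∞ :=
  ⨅ Y ∈ K, ⨅ _ : Y ≠ 0, ENNReal.ofReal (‖measurementMap A Y‖ / frobNorm Y)

/-- `X` solves: minimize `f` over those `X ∈ L` with `‖𝒜 X - y‖ ≤ η`. -/
def IsSolution (f : Matrix n n 𝕜 → ℝ) (L : Submodule ℝ (Matrix n n 𝕜))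
    (A : Fin m → Matrix n n 𝕜) (y : EuclideanSpace 𝕜 (Fin m)) (η : ℝ)
    (X : Matrix n n 𝕜) : Prop :=
  (X ∈ L ∧ ‖measurementMap A X - y‖ ≤ η) ∧
    ∀ Z ∈ L, ‖measurementMap A Z - y‖ ≤ η → f X ≤ f Z

/-- Uniform stable recovery with constant `C` of all signals in `S` by minimization of `f`: for
every signal in `S`, every noise vector and every noise bound, the minimization has a solution,
and each solution has Frobenius error at most `η / (C √m)`. -/
def StablyRecovers (f : Matrix n n 𝕜 → ℝ) (L : Submodule ℝ (Matrix n n 𝕜))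
    (S : Set (Matrix n n 𝕜)) (A : Fin m → Matrix n n 𝕜) (C : ℝ) : Prop :=
  ∀ X₀ ∈ L, X₀ ∈ S → ∀ (e : EuclideanSpace 𝕜 (Fin m)) (η : ℝ), ‖e‖ ≤ η →
    (∃ X, IsSolution f L A (measurementMap A X₀ + e) η X) ∧
    ∀ X, IsSolution f L A (measurementMap A X₀ + e) η X →
      frobNorm (X - X₀) ≤ η / (C * √m)

/-- The small ball function `inf_{Y ∈ E} Pr[|Tr (A Y)| ≥ ξ]` for a random matrix `A` of law
`ν`. -/
def smallBall (ν : Measure (Matrix n n 𝕜)) (ξ : ℝ) (E : Set (Matrix n n 𝕜)) : ℝ≥0∞ :=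
  ⨅ Y ∈ E, ν {A | ξ ≤ ‖(A * Y).trace‖}

variable {Ω : Type*} [MeasurableSpace Ω]

/-- `A₁, …, Aₘ` are independent random matrices, each of law `ν`. -/
structure IsIIDSample (P : Measure Ω) (ν : Measure (Matrix n n 𝕜))
    (A : Fin m → Ω → Matrix n n 𝕜) : Prop where
  measurable : ∀ i, Measurable (A i)
  indep : iIndepFun A P
  law : ∀ i, P.map (A i) = ν

/-- `𝔼 ‖H‖` for `H = m^(-1/2) ∑ⱼ εⱼ Aⱼ` and the spectral norm, where `ε` is a Rademacher
sequence independent of `A`, i.e. uniformly distributed over all sign vectors in `{±1}ᵐ`. -/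
def expSpecNorm [DecidableEq n] (P : Measure Ω) (A : Fin m → Ω → Matrix n n 𝕜) : ℝ≥0∞ :=
  ((2 : ℝ≥0∞) ^ m)⁻¹ * ∑ ε : Fin m → ℤˣ,
    ∫⁻ ω, ENNReal.ofReal
      (specNorm ((1 / √m : ℝ) • ∑ j, (((ε j : ℤ) : ℝ) • A j ω))) ∂P

/-- The hypotheses on the measurement ensemble: it is i.i.d., the small ball function at `2ξ` of
the Frobenius-unit vectors in the union of the nuclear norm descent cones anchored at nonzero
matrices of rank at most `r` is at least `C₁`, and `𝔼 ‖H‖ ≤ C₂ √(m/r)`. -/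
structure MeetsCriteria [DecidableEq n] (P : Measure Ω) (ν : Measure (Matrix n n 𝕜))
    (A : Fin m → Ω → Matrix n n 𝕜) (L : Submodule ℝ (Matrix n n 𝕜)) (r : ℕ)
    (ξ C₁ C₂ : ℝ) : Prop where
  iid : IsIIDSample P ν A
  small_ball : ENNReal.ofReal C₁ ≤
    smallBall ν (2 * ξ) {Y ∈ coneUnion nuclearNorm L (rankLE r) | frobNorm Y = 1}
  width : expSpecNorm P A ≤ ENNReal.ofReal (C₂ * √(m / r))

/-- With probability at least `p` the property `E` holds (on a measurable event, as `E` itself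
need not be measurable). -/
def WithProb (P : Measure Ω) (p : ℝ) (E : Ω → Prop) : Prop :=
  ∃ G : Set Ω, MeasurableSet G ∧ ENNReal.ofReal p ≤ P G ∧ ∀ ω ∈ G, E ω

end Measurements

end SquareRecovery

end

/-! Everything reduces to a lower bound for `minConicSV` over the nuclear norm descent cones. The
error of a minimizer is a descent direction at the signal, and since minimizer and signal are both
feasible, the measurement map sends the error to a vector of norm at most 2η. If that map expands
the descent directions by 2c√m, the error is at most η/(c√m); this is
`stablyRecovers_of_le_minConicSV`. The square norm needs no new estimate. It dominates the nuclear
norm (take both factors equal to the identity), so wherever the two agree its descent cone lies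
inside the nuclear one, and every lower bound carries over (`coneUnion_squareNorm_subset`).

The lower bound itself is Mendelson's small ball method. For a unit Y in the cone, ∑ |Tr(AₖY)|
dominates a sum of truncated terms, each of mean at least ξC₁. The deviation from the mean,
uniformly in Y, is controlled in expectation by `symmetrization`. After that
`rademacher_contraction` removes the truncation, and the duality of nuclear and spectral norm leaves
‖Y‖_* times the spectral norm of a signed sum of the Aₖ. By `nuclearNorm_le_of_mem_descentCone`,
‖Y‖_* ≤ (1+√2)√r, which cancels the 1/√r in the width hypothesis, so the loss is at most 2(1+√2)C₂m.

Write Δ = ξC₁ - 2(1+√2)C₂. Since the terms are bounded, bounded differences keep the random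
fluctuation below mΔ/2 outside an event of probability exp(-mΔ²/(32ξ²)). The remaining mΔ/2 is an ℓ¹
bound, and Cauchy-Schwarz turns it into an ℓ² bound √m·Δ/2 = 2(Δ/4)√m. -/

noncomputable section

namespace SquareRecovery

/-! ### Frobenius norm as a Euclidean norm -/

section LinearAlgebra

variable {𝕜 : Type*} [RCLike 𝕜] {n : Type*} [Fintype n]

/-- The entries of a matrix as a vector of Euclidean space. -/
def vectorize (X : Matrix n n 𝕜) : EuclideanSpace 𝕜 (n × n) :=
  WithLp.toLp 2 fun p => X p.1 p.2

lemma inner_vectorize (X Y : Matrix n n 𝕜) :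
    inner 𝕜 (vectorize X) (vectorize Y) = (Xᴴ * Y).trace := by
  simp only [vectorize, PiLp.inner_apply, Matrix.trace, Matrix.diag, Matrix.mul_apply,
    Fintype.sum_prod_type, Matrix.conjTranspose_apply, RCLike.inner_apply]
  rw [Finset.sum_comm]
  exact Finset.sum_congr rfl fun _ _ => Finset.sum_congr rfl fun _ _ => by
    rw [mul_comm]; rfl

lemma frobNorm_eq_norm (X : Matrix n n 𝕜) : frobNorm X = ‖vectorize X‖ := by
  rw [frobNorm, ← inner_vectorize, inner_self_eq_norm_sq, Real.sqrt_sq (norm_nonneg _)]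

lemma frobNorm_nonneg (X : Matrix n n 𝕜) : 0 ≤ frobNorm X := Real.sqrt_nonneg _

lemma frobNorm_sq (X : Matrix n n 𝕜) : frobNorm X ^ 2 = RCLike.re (Xᴴ * X).trace := by
  rw [frobNorm_eq_norm, ← inner_vectorize, inner_self_eq_norm_sq]

lemma frobNorm_eq_zero {X : Matrix n n 𝕜} : frobNorm X = 0 ↔ X = 0 := by
  rw [frobNorm_eq_norm, norm_eq_zero]
  refine ⟨fun h => ?_, fun h => by subst h; rfl⟩
  ext i j
  simpa [vectorize] using congrArg (fun v : EuclideanSpace 𝕜 (n × n) => v (i, j)) h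

lemma frobNorm_smul (c : ℝ) (X : Matrix n n 𝕜) : frobNorm (c • X) = |c| * frobNorm X := by
  have : vectorize (c • X) = c • vectorize X := rfl
  rw [frobNorm_eq_norm, frobNorm_eq_norm, this, norm_smul, Real.norm_eq_abs]

lemma frobNorm_conjTranspose (X : Matrix n n 𝕜) : frobNorm Xᴴ = frobNorm X := by
  rw [frobNorm, frobNorm, Matrix.conjTranspose_conjTranspose, Matrix.trace_mul_comm]

lemma norm_entry_le_frobNorm (X : Matrix n n 𝕜) (i j : n) : ‖X i j‖ ≤ frobNorm X := by
  rw [frobNorm_eq_norm]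
  exact PiLp.norm_apply_le (vectorize X) (i, j)

lemma continuous_frobNorm : Continuous (frobNorm : Matrix n n 𝕜 → ℝ) := by
  unfold frobNorm
  fun_prop

lemma norm_trace_mul_le_frobNorm (X Y : Matrix n n 𝕜) :
    ‖(X * Y).trace‖ ≤ frobNorm X * frobNorm Y := by
  have := norm_inner_le_norm (𝕜 := 𝕜) (vectorize Xᴴ) (vectorize Y)
  rwa [inner_vectorize, Matrix.conjTranspose_conjTranspose, ← frobNorm_eq_norm,
    ← frobNorm_eq_norm, frobNorm_conjTranspose] at this

lemma frobNorm_sq_eq_sum_col (X : Matrix n n 𝕜) :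
    frobNorm X ^ 2 = ∑ j, ‖(WithLp.toLp 2 (X.col j) : EuclideanSpace 𝕜 n)‖ ^ 2 := by
  simp only [frobNorm_eq_norm, EuclideanSpace.norm_sq_eq, vectorize, Fintype.sum_prod_type]
  exact Finset.sum_comm

variable [DecidableEq n]

/-! ### Spectral norm, contractions and orthogonality -/

section OperatorNorm

open scoped Matrix.Norms.L2Operator

lemma specNorm_eq_norm (X : Matrix n n 𝕜) : specNorm X = ‖X‖ := rfl

lemma specNorm_nonneg (X : Matrix n n 𝕜) : 0 ≤ specNorm X := norm_nonneg _

lemma specNorm_mul_le (X Y : Matrix n n 𝕜) : specNorm (X * Y) ≤ specNorm X * specNorm Y :=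
  norm_mul_le X Y

lemma specNorm_conjTranspose (X : Matrix n n 𝕜) : specNorm Xᴴ = specNorm X :=
  Matrix.l2_opNorm_conjTranspose X

/-- Contractions, in terms of quadratic forms. -/
lemma specNorm_le_one_of_mulVec {X : Matrix n n 𝕜}
    (h : ∀ x : EuclideanSpace 𝕜 n, ‖Matrix.toEuclideanCLM (n := n) (𝕜 := 𝕜) X x‖ ≤ ‖x‖) :
    specNorm X ≤ 1 :=
  ContinuousLinearMap.opNorm_le_bound _ zero_le_one fun x => by simpa using h x

lemma specNorm_mulVec_le (X : Matrix n n 𝕜) (x : EuclideanSpace 𝕜 n) :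
    ‖Matrix.toEuclideanCLM (n := n) (𝕜 := 𝕜) X x‖ ≤ specNorm X * ‖x‖ :=
  ContinuousLinearMap.le_opNorm _ _

lemma specNorm_le_one_of_unitary {U : Matrix n n 𝕜} (hU : Uᴴ * U = 1) : specNorm U ≤ 1 := by
  have h := Matrix.l2_opNorm_conjTranspose_mul_self U
  rw [hU, specNorm_eq_norm] at *
  -- Only an inequality, since the index type may be empty.
  have h1 : ‖(1 : Matrix n n 𝕜)‖ ≤ 1 := by
    rw [Matrix.cstar_norm_def, map_one]
    exact ContinuousLinearMap.norm_id_le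
  nlinarith [norm_nonneg U]

lemma specNorm_le_one_of_isIdempotent {P : Matrix n n 𝕜} (hP : Pᴴ = P) (hPP : P * P = P) :
    specNorm P ≤ 1 := by
  have h := Matrix.l2_opNorm_conjTranspose_mul_self P
  rw [hP, hPP] at h
  rw [specNorm_eq_norm]
  nlinarith [norm_nonneg P]

/-- The C*-identity reduces this to `Sᴴ * S`, which is a self-adjoint idempotent; for such a P the
same identity reads ‖P‖² = ‖P‖. -/
lemma specNorm_le_one_of_isPartialIsometry {S : Matrix n n 𝕜} (hS : S * Sᴴ * S = S) :
    specNorm S ≤ 1 := by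
  have h := Matrix.l2_opNorm_conjTranspose_mul_self S
  have h1 : specNorm (Sᴴ * S) ≤ 1 := by
    apply specNorm_le_one_of_isIdempotent
    · simp
    · rw [Matrix.mul_assoc, ← Matrix.mul_assoc S, hS]
  rw [specNorm_eq_norm] at *
  nlinarith [norm_nonneg S]

lemma norm_entry_le_specNorm (X : Matrix n n 𝕜) (i j : n) : ‖X i j‖ ≤ specNorm X := by
  have h := specNorm_mulVec_le X (EuclideanSpace.single j 1)
  rw [PiLp.norm_single, norm_one, mul_one] at h
  refine le_trans ?_ h
  have := PiLp.norm_apply_le (Matrix.toEuclideanCLM (n := n) (𝕜 := 𝕜) X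
    (EuclideanSpace.single j 1)) i
  refine le_trans (le_of_eq ?_) this
  simp [Matrix.ofLp_toEuclideanCLM]

lemma frobNorm_mul_le (X Y : Matrix n n 𝕜) : frobNorm (X * Y) ≤ specNorm X * frobNorm Y := by
  refine le_of_pow_le_pow_left₀ two_ne_zero (mul_nonneg (specNorm_nonneg _) (frobNorm_nonneg _)) ?_
  rw [mul_pow, frobNorm_sq_eq_sum_col, frobNorm_sq_eq_sum_col, Finset.mul_sum]
  refine Finset.sum_le_sum fun j _ => ?_
  rw [← mul_pow]
  exact pow_le_pow_left₀ (norm_nonneg _) (specNorm_mulVec_le X (WithLp.toLp 2 (Y.col j))) 2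

lemma frobNorm_mul_le' (X Y : Matrix n n 𝕜) : frobNorm (X * Y) ≤ frobNorm X * specNorm Y := by
  rw [← frobNorm_conjTranspose, Matrix.conjTranspose_mul, mul_comm, ← frobNorm_conjTranspose X,
    ← specNorm_conjTranspose]
  exact frobNorm_mul_le _ _

/-- The hypothesis makes the ranges of the two matrices orthogonal, so Pythagoras applies vector by
vector. -/
lemma norm_sq_add_of_orthogonal {A B : Matrix n n 𝕜} (h : Aᴴ * B = 0) (x : EuclideanSpace 𝕜 n) :
    ‖Matrix.toEuclideanCLM (n := n) (𝕜 := 𝕜) (A + B) x‖ ^ 2 =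
      ‖Matrix.toEuclideanCLM (n := n) (𝕜 := 𝕜) A x‖ ^ 2 +
      ‖Matrix.toEuclideanCLM (n := n) (𝕜 := 𝕜) B x‖ ^ 2 := by
  have h1 : inner 𝕜 (Matrix.toEuclideanCLM (n := n) (𝕜 := 𝕜) A x)
      (Matrix.toEuclideanCLM (n := n) (𝕜 := 𝕜) B x) = 0 := by
    rw [← ContinuousLinearMap.adjoint_inner_right, ← ContinuousLinearMap.star_eq_adjoint,
      ← map_star, ← mul_apply_eq_comp, ← map_mul, Matrix.star_eq_conjTranspose, h,
      map_zero, zero_apply, inner_zero_right]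
  rw [map_add, add_apply, @norm_add_sq 𝕜, h1]
  simp

lemma frobNorm_sq_add_of_isIdempotent {P : Matrix n n 𝕜} (hP : Pᴴ = P) (hPP : P * P = P)
    (Y : Matrix n n 𝕜) :
    frobNorm (P * Y) ^ 2 + frobNorm ((1 - P) * Y) ^ 2 = frobNorm Y ^ 2 := by
  have h : Pᴴ * (1 - P) = 0 := by rw [hP, Matrix.mul_sub, hPP, Matrix.mul_one, sub_self]
  simp only [frobNorm_sq_eq_sum_col, ← Finset.sum_add_distrib]
  refine Finset.sum_congr rfl fun j _ => ?_
  have := norm_sq_add_of_orthogonal h (WithLp.toLp 2 (Y.col j))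
  rw [add_sub_cancel, map_one, one_apply_eq_self] at this
  exact this.symm

end OperatorNorm

/-! ### Polar decomposition and the duality of nuclear and spectral norm -/

open scoped ComplexOrder in
/-- Singular value decomposition: `S` is the adjoint of the partial isometry in the polar
decomposition of `X`. -/
theorem exists_polar (X : Matrix n n 𝕜) : ∃ S : Matrix n n 𝕜, S * Sᴴ * S = S ∧ Sᴴ * S * X = X ∧
    X * (S * Sᴴ) = X ∧ (S * X).trace = (nuclearNorm X : 𝕜) ∧
    RCLike.re (S * Sᴴ).trace = X.rank ∧
    ∀ H : Matrix n n 𝕜, ‖(H * X).trace‖ ≤ specNorm H * nuclearNorm X := by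
  have hA : (Xᴴ * X).IsHermitian := Matrix.isHermitian_conjTranspose_mul_self X
  set E : Matrix n n 𝕜 := (hA.eigenvectorUnitary : Matrix n n 𝕜) with hE
  have hEE : Eᴴ * E = 1 := by
    rw [← Matrix.star_eq_conjTranspose]; exact Unitary.star_mul_self_of_mem hA.eigenvectorUnitary.2
  set lam := hA.eigenvalues with hlam
  have hlam0 : ∀ i, 0 ≤ lam i := (Matrix.posSemidef_conjTranspose_mul_self X).eigenvalues_nonneg
  let D (f : ℝ → ℝ) : Matrix n n 𝕜 := Matrix.diagonal fun i => ((f (lam i) : ℝ) : 𝕜)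
  have hD : ∀ f g, D f * D g = D (f * g) := by
    intro f g
    simp [D, Matrix.diagonal_mul_diagonal]
  have hDH : ∀ f, (D f)ᴴ = D f := by
    intro f
    simp only [D, Matrix.diagonal_conjTranspose]
    congr 1
    ext i
    simp
  have hDcongr : ∀ f g : ℝ → ℝ, (∀ x, 0 ≤ x → f x = g x) → D f = D g := by
    intro f g h
    simp only [D]
    congr 1; ext i; rw [h _ (hlam0 i)]
  -- Functional calculus of `Xᴴ * X` written out in an eigenbasis. Products and traces then reduce
  -- to scalar identities on [0, ∞), where the eigenvalues lie.
  let F (f : ℝ → ℝ) : Matrix n n 𝕜 := E * D f * Eᴴ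
  have hF : ∀ f g, F f * F g = F (f * g) := by
    intro f g
    simp only [F]
    rw [← hD, show E * D f * Eᴴ * (E * D g * Eᴴ) = E * D f * (Eᴴ * E) * D g * Eᴴ by
      simp only [Matrix.mul_assoc], hEE, Matrix.mul_one]
    simp only [Matrix.mul_assoc]
  have hFH : ∀ f, (F f)ᴴ = F f := by
    intro f
    simp only [F, Matrix.conjTranspose_mul, hDH, Matrix.conjTranspose_conjTranspose,
      Matrix.mul_assoc]
  have hFcongr : ∀ f g : ℝ → ℝ, (∀ x, 0 ≤ x → f x = g x) → F f = F g := by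
    intro f g h
    simp only [F, hDcongr f g h]
  have hXX : Xᴴ * X = F id := by
    conv_lhs => rw [hA.spectral_theorem]
    simp only [Unitary.conjStarAlgAut_apply, F, D, Matrix.star_eq_conjTranspose]
    rfl
  have hcfc : cfc Real.sqrt (Xᴴ * X) = F Real.sqrt := by
    rw [hA.cfc_eq]
    simp only [Matrix.IsHermitian.cfc, Unitary.conjStarAlgAut_apply, F, D,
      Matrix.star_eq_conjTranspose]
    rfl
  have htr : ∀ f, (F f).trace = ((∑ i, f (lam i) : ℝ) : 𝕜) := by
    intro f
    simp only [F]
    rw [Matrix.trace_mul_comm, ← Matrix.mul_assoc, hEE, Matrix.one_mul]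
    simp [D, Matrix.trace_diagonal]
  have hnuc : nuclearNorm X = ∑ i, √(lam i) := by
    rw [nuclearNorm, hcfc, htr, RCLike.ofReal_re]
  -- `q` gives the projection onto the support of `Xᴴ * X`. In `s` the convention that the inverse
  -- of 0 is 0 yields the pseudo-inverse, so `F s * Xᴴ` is a partial isometry even for singular `X`.
  set q : ℝ → ℝ := fun x => if x = 0 then 0 else 1 with hq
  set s : ℝ → ℝ := fun x => (√x)⁻¹ with hs
  have hXQ : X * F q = X := by
    have h0 : X * (1 - F q) = 0 := by
      rw [← Matrix.conjTranspose_mul_self_eq_zero, Matrix.conjTranspose_mul, Matrix.mul_assoc,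
        ← Matrix.mul_assoc Xᴴ, hXX, Matrix.mul_sub, Matrix.mul_one, hF,
        hFcongr (id * q) id (by intro x hx; by_cases h : x = 0 <;> simp [q, h]), sub_self,
        Matrix.mul_zero]
    rw [Matrix.mul_sub, Matrix.mul_one, sub_eq_zero] at h0
    exact h0.symm
  set S := F s * Xᴴ with hS
  have hSH : Sᴴ = X * F s := by
    rw [hS, Matrix.conjTranspose_mul, hFH, Matrix.conjTranspose_conjTranspose]
  have hSS : S * Sᴴ = F q := by
    rw [hSH, hS, Matrix.mul_assoc, ← Matrix.mul_assoc Xᴴ, hXX, hF, hF]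
    apply hFcongr
    intro x hx
    by_cases h : x = 0
    · simp [h, q, s]
    · have : √x ≠ 0 := by rw [Real.sqrt_ne_zero hx]; exact h
      simp only [Pi.mul_apply, id, s, q, h, if_false]
      field_simp
      rw [Real.sq_sqrt hx]
  have hSX : S * X = F Real.sqrt := by
    rw [hS, Matrix.mul_assoc, hXX, hF]
    apply hFcongr
    intro x hx
    simp only [Pi.mul_apply, id, s]
    rw [inv_mul_eq_div, Real.div_sqrt]
  have hqs : ∀ x, 0 ≤ x → (q * s) x = s x := by
    intro x _
    by_cases h : x = 0 <;> simp [q, s, h]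
  have hSSS : S * Sᴴ * S = S := by
    rw [hSS, hS, ← Matrix.mul_assoc, hF, hFcongr _ _ hqs]
  have hSSX : Sᴴ * S * X = X := by
    rw [Matrix.mul_assoc, hSX, hSH, Matrix.mul_assoc, hF, hFcongr (s * Real.sqrt) q, hXQ]
    intro x hx
    by_cases h : x = 0
    · simp [h, q, s]
    · have : √x ≠ 0 := by rw [Real.sqrt_ne_zero hx]; exact h
      simp [q, s, h, this]
  refine ⟨S, hSSS, hSSX, by rw [hSS, hXQ], by rw [hSX, htr, hnuc], ?_, ?_⟩
  · rw [hSS, htr, RCLike.ofReal_re, ← Matrix.rank_conjTranspose_mul_self X,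
      hA.rank_eq_card_non_zero_eigs, Fintype.card_subtype]
    simp [q, Finset.sum_ite, ← hlam]
  · intro H
    have hX : X = Sᴴ * (E * D Real.sqrt * Eᴴ) := by
      conv_lhs => rw [← hSSX, Matrix.mul_assoc, hSX]
    -- In the eigenbasis the trace pairs the singular values with diagonal entries of a matrix whose
    -- spectral norm is at most that of `H`.
    have h1 : (H * X).trace = ∑ i, (Eᴴ * H * Sᴴ * E) i i * (√(lam i) : ℝ) := by
      conv_lhs => rw [hX]
      rw [show H * (Sᴴ * (E * D Real.sqrt * Eᴴ)) = H * Sᴴ * E * D Real.sqrt * Eᴴ by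
        simp only [Matrix.mul_assoc], Matrix.trace_mul_comm,
        show Eᴴ * (H * Sᴴ * E * D Real.sqrt) = Eᴴ * H * Sᴴ * E * D Real.sqrt by
        simp only [Matrix.mul_assoc]]
      simp [D, Matrix.trace]
    have h2 : specNorm (Eᴴ * H * Sᴴ * E) ≤ specNorm H := by
      have e1 : specNorm E ≤ 1 := specNorm_le_one_of_unitary hEE
      have e2 : specNorm Eᴴ ≤ 1 := by rwa [specNorm_conjTranspose]
      have e3 : specNorm Sᴴ ≤ 1 := by
        rw [specNorm_conjTranspose]; exact specNorm_le_one_of_isPartialIsometry hSSS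
      calc specNorm (Eᴴ * H * Sᴴ * E) ≤ specNorm Eᴴ * specNorm H * specNorm Sᴴ * specNorm E := by
            refine (specNorm_mul_le _ _).trans ?_
            gcongr
            · exact specNorm_nonneg _
            refine (specNorm_mul_le _ _).trans ?_
            gcongr
            · exact specNorm_nonneg _
            exact specNorm_mul_le _ _
        _ ≤ 1 * specNorm H * 1 * 1 := by
            gcongr <;> first | exact specNorm_nonneg _ | skip
            exact mul_nonneg (mul_nonneg zero_le_one (specNorm_nonneg _)) zero_le_one
            exact mul_nonneg zero_le_one (specNorm_nonneg _)
        _ = specNorm H := by ring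
    rw [h1, hnuc, Finset.mul_sum]
    refine (norm_sum_le _ _).trans (Finset.sum_le_sum fun i _ => ?_)
    rw [norm_mul, RCLike.norm_ofReal, abs_of_nonneg (Real.sqrt_nonneg _)]
    gcongr
    exact (norm_entry_le_specNorm _ i i).trans h2

lemma nuclearNorm_nonneg (X : Matrix n n 𝕜) : 0 ≤ nuclearNorm X := by
  obtain ⟨S, -, -, -, hS, -, hX⟩ := exists_polar X
  by_contra! h
  have h1 := hX S
  rw [hS, RCLike.norm_ofReal] at h1
  nlinarith [specNorm_nonneg S, abs_pos.2 h.ne]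

lemma norm_trace_mul_le (H X : Matrix n n 𝕜) :
    ‖(H * X).trace‖ ≤ specNorm H * nuclearNorm X := by
  obtain ⟨S, -, -, -, -, -, hX⟩ := exists_polar X
  exact hX H

lemma norm_trace_mul_le_nuclearNorm {U : Matrix n n 𝕜} (hU : specNorm U ≤ 1)
    (X : Matrix n n 𝕜) : ‖(U * X).trace‖ ≤ nuclearNorm X :=
  (norm_trace_mul_le U X).trans (mul_le_of_le_one_left (nuclearNorm_nonneg X) hU)

/-- The nuclear norm is attained by a contraction. -/
lemma exists_trace_mul_eq_nuclearNorm (X : Matrix n n 𝕜) :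
    ∃ U : Matrix n n 𝕜, specNorm U ≤ 1 ∧ (U * X).trace = (nuclearNorm X : 𝕜) := by
  obtain ⟨S, hS, -, -, h, -, -⟩ := exists_polar X
  exact ⟨S, specNorm_le_one_of_isPartialIsometry hS, h⟩

/-- The dual description of the nuclear norm as a supremum over contractions; subadditivity and the
entrywise bounds follow from it. -/
lemma nuclearNorm_le_iff {X : Matrix n n 𝕜} {c : ℝ} :
    nuclearNorm X ≤ c ↔ ∀ U : Matrix n n 𝕜, specNorm U ≤ 1 → ‖(U * X).trace‖ ≤ c := by
  refine ⟨fun h U hU => (norm_trace_mul_le_nuclearNorm hU X).trans h, fun h => ?_⟩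
  obtain ⟨U, hU, hX⟩ := exists_trace_mul_eq_nuclearNorm X
  have := h U hU
  rw [hX, RCLike.norm_ofReal] at this
  exact (le_abs_self _).trans this

lemma nuclearNorm_add_le (X Y : Matrix n n 𝕜) :
    nuclearNorm (X + Y) ≤ nuclearNorm X + nuclearNorm Y := by
  refine nuclearNorm_le_iff.2 fun U hU => ?_
  rw [Matrix.mul_add, Matrix.trace_add]
  exact (norm_add_le _ _).trans
    (add_le_add (norm_trace_mul_le_nuclearNorm hU X) (norm_trace_mul_le_nuclearNorm hU Y))

lemma nuclearNorm_le_sum (X : Matrix n n 𝕜) : nuclearNorm X ≤ ∑ i, ∑ j, ‖X j i‖ := by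
  refine nuclearNorm_le_iff.2 fun U hU => ?_
  simp only [Matrix.trace, Matrix.diag, Matrix.mul_apply]
  refine (norm_sum_le _ _).trans (Finset.sum_le_sum fun i _ => (norm_sum_le _ _).trans
    (Finset.sum_le_sum fun j _ => ?_))
  rw [norm_mul]
  exact mul_le_of_le_one_left (norm_nonneg _) ((norm_entry_le_specNorm U i j).trans hU)

lemma abs_nuclearNorm_sub_le (X Y : Matrix n n 𝕜) :
    |nuclearNorm X - nuclearNorm Y| ≤ ∑ i, ∑ j, ‖X j i - Y j i‖ := by
  have h1 := nuclearNorm_add_le Y (X - Y)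
  have h2 := nuclearNorm_add_le X (Y - X)
  have h3 := nuclearNorm_le_sum (X - Y)
  have h4 := nuclearNorm_le_sum (Y - X)
  simp only [Matrix.sub_apply] at h3 h4
  simp only [norm_sub_rev (Y _ _)] at h4
  rw [add_sub_cancel] at h1 h2
  rw [abs_sub_le_iff]
  constructor <;> linarith

lemma continuous_nuclearNorm : Continuous (nuclearNorm : Matrix n n 𝕜 → ℝ) := by
  rw [continuous_iff_continuousAt]
  intro Y
  rw [ContinuousAt, tendsto_iff_dist_tendsto_zero]
  refine squeeze_zero (fun _ => dist_nonneg) (fun X => abs_nuclearNorm_sub_le X Y) ?_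
  have : Continuous fun X : Matrix n n 𝕜 => ∑ i, ∑ j, ‖X j i - Y j i‖ := by fun_prop
  simpa using this.tendsto Y

lemma specNorm_le_frobNorm (X : Matrix n n 𝕜) : specNorm X ≤ frobNorm X := by
  refine ContinuousLinearMap.opNorm_le_bound _ (frobNorm_nonneg X) fun x => ?_
  refine le_of_pow_le_pow_left₀ two_ne_zero (mul_nonneg (frobNorm_nonneg _) (norm_nonneg _)) ?_
  rw [mul_pow, frobNorm_eq_norm, EuclideanSpace.norm_sq_eq, EuclideanSpace.norm_sq_eq (𝕜 := 𝕜) x,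
    EuclideanSpace.norm_sq_eq, Fintype.sum_prod_type, Finset.sum_mul]
  refine Finset.sum_le_sum fun i _ => ?_
  rw [Matrix.ofLp_toEuclideanCLM, Matrix.mulVec, dotProduct]
  refine (pow_le_pow_left₀ (norm_nonneg _) (norm_sum_le _ _) 2).trans ?_
  simp only [norm_mul]
  exact Finset.sum_mul_sq_le_sq_mul_sq _ _ _

/-- By duality ‖X‖_F² = Tr(X†X) ≤ ‖X‖_∞‖X‖_* ≤ ‖X‖_F‖X‖_*; divide by ‖X‖_F. -/
lemma frobNorm_le_nuclearNorm (X : Matrix n n 𝕜) : frobNorm X ≤ nuclearNorm X := by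
  rcases (frobNorm_nonneg X).eq_or_lt with h | h
  · rw [← h]; exact nuclearNorm_nonneg X
  have h1 := norm_trace_mul_le Xᴴ X
  rw [specNorm_conjTranspose] at h1
  have h2 : frobNorm X ^ 2 ≤ specNorm X * nuclearNorm X := by
    rw [frobNorm_sq]; exact (RCLike.re_le_norm _).trans h1
  have h3 := mul_le_mul_of_nonneg_right (specNorm_le_frobNorm X) (nuclearNorm_nonneg X)
  nlinarith

lemma nuclearNorm_zero : nuclearNorm (0 : Matrix n n 𝕜) = 0 :=
  le_antisymm (by simpa using nuclearNorm_le_sum (0 : Matrix n n 𝕜)) (nuclearNorm_nonneg _)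

/-! ### Geometry of the nuclear norm descent cone -/

/-- Elements of a descent cone of the nuclear norm at a matrix of rank at most `r` have nuclear
norm comparable to their Frobenius norm. -/
theorem nuclearNorm_le_of_mem_descentCone {X Y : Matrix n n 𝕜} {r : ℕ} (hX : X.rank ≤ r)
    (hY : Y ∈ descentCone nuclearNorm X) :
    nuclearNorm Y ≤ (1 + √2) * √r * frobNorm Y := by
  obtain ⟨S, hSSS, hPX, hXQ, hSX, hrank, -⟩ := exists_polar X
  have hr : RCLike.re (S * Sᴴ).trace ≤ r := by rw [hrank]; exact_mod_cast hX
  set P := Sᴴ * S with hPdef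
  set Q := S * Sᴴ with hQdef
  have hP : Pᴴ = P := by simp [hPdef]
  have hQ : Qᴴ = Q := by simp [hQdef]
  have hSP : S * P = S := by rw [hPdef, ← Matrix.mul_assoc]; exact hSSS
  have hPP : P * P = P := by rw [hPdef, Matrix.mul_assoc, hSP]
  have hQQ : Q * Q = Q := by
    conv_lhs => rw [hQdef, ← Matrix.mul_assoc, ← hQdef, hSSS]
  have hQ' : (1 - Q)ᴴ = 1 - Q := by rw [Matrix.conjTranspose_sub, hQ, Matrix.conjTranspose_one]
  have hQQ' : (1 - Q) * (1 - Q) = 1 - Q := by simp [Matrix.mul_sub, Matrix.sub_mul, hQQ]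
  have nQ' : specNorm (1 - Q) ≤ 1 := specNorm_le_one_of_isIdempotent hQ' hQQ'
  have nS : specNorm S ≤ 1 := specNorm_le_one_of_isPartialIsometry hSSS
  have fS : frobNorm S ≤ √r := by
    apply Real.le_sqrt_of_sq_le
    rw [frobNorm_sq, Matrix.trace_mul_comm]; exact hr
  have fP : frobNorm P ≤ √r := by
    apply Real.le_sqrt_of_sq_le
    rw [frobNorm_sq, hP, hPP, hPdef, Matrix.trace_mul_comm]; exact hr
  have fQ : frobNorm Q ≤ √r := by
    apply Real.le_sqrt_of_sq_le
    rw [frobNorm_sq, hQ, hQQ]; exact hr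
  have hF := frobNorm_nonneg Y
  -- the part of `Y` orthogonal to the tangent space
  set Z := (1 - P) * Y * (1 - Q) with hZ
  obtain ⟨T, hT, hTZ⟩ := exists_trace_mul_eq_nuclearNorm Z
  -- `P` and `Q` project onto the column and row spaces of `X`. Here `S + R` is a subgradient of the
  -- nuclear norm at `X`: a contraction, because `S` and `R` have orthogonal supports and orthogonal
  -- ranges, pairing with `X` to give its nuclear norm. The choice of `T` makes `R` detect the
  -- nuclear norm of `Z`.
  set R := (1 - Q) * T * (1 - P) with hR
  have hcontr : specNorm (S + R) ≤ 1 := by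
    refine specNorm_le_one_of_mulVec fun x => ?_
    refine le_of_pow_le_pow_left₀ two_ne_zero (norm_nonneg _) ?_
    have o1 : Sᴴ * R = 0 := by
      have : Sᴴ * (1 - Q) = 0 := by
        rw [Matrix.mul_sub, Matrix.mul_one, hQdef, ← Matrix.mul_assoc, ← hPdef, ← hP,
          ← Matrix.conjTranspose_mul, hSP, sub_self]
      rw [hR, ← Matrix.mul_assoc, ← Matrix.mul_assoc, this, Matrix.zero_mul, Matrix.zero_mul]
    have o2 : Pᴴ * (1 - P) = 0 := by rw [hP, Matrix.mul_sub, hPP, Matrix.mul_one, sub_self]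
    have e2 := norm_sq_add_of_orthogonal o2 x
    rw [add_sub_cancel, map_one, one_apply_eq_self] at e2
    rw [norm_sq_add_of_orthogonal o1, e2]
    apply add_le_add
    · apply pow_le_pow_left₀ (norm_nonneg _)
      conv_lhs => rw [← hSP, map_mul, mul_apply_eq_comp]
      exact (specNorm_mulVec_le S _).trans (mul_le_of_le_one_left (norm_nonneg _) nS)
    · apply pow_le_pow_left₀ (norm_nonneg _)
      rw [hR, map_mul, mul_apply_eq_comp]
      refine (specNorm_mulVec_le _ _).trans (mul_le_of_le_one_left (norm_nonneg _) ?_)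
      exact (specNorm_mul_le _ _).trans (mul_le_one₀ nQ' (specNorm_nonneg _) hT)
  -- hence descent directions have small orthogonal part
  have hZle : nuclearNorm Z ≤ √r * frobNorm Y := by
    simp only [descentCone, Set.mem_iUnion, Set.mem_ofPred_eq] at hY
    obtain ⟨τ, hτ, hle⟩ := hY
    have h1 := (RCLike.re_le_norm _).trans (norm_trace_mul_le_nuclearNorm hcontr (X + τ • Y))
    have hRX : (R * X).trace = 0 := by
      have : (1 - P) * X = 0 := by rw [Matrix.sub_mul, hPX, Matrix.one_mul, sub_self]
      rw [hR, Matrix.mul_assoc, this, Matrix.mul_zero, Matrix.trace_zero]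
    have hRY : (R * Y).trace = (nuclearNorm Z : 𝕜) := by
      rw [← hTZ, hR, hZ, Matrix.mul_assoc, Matrix.mul_assoc, Matrix.trace_mul_comm]
      simp only [Matrix.mul_assoc]
    rw [Matrix.mul_add, Matrix.add_mul, Matrix.add_mul, Matrix.mul_smul, Matrix.mul_smul,
      Matrix.trace_add, Matrix.trace_add, Matrix.trace_add, Matrix.trace_smul, Matrix.trace_smul,
      hSX, hRX, hRY] at h1
    simp only [map_add, RCLike.smul_re, RCLike.ofReal_re, map_zero] at h1
    have h2 : |RCLike.re (S * Y).trace| ≤ √r * frobNorm Y :=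
      (RCLike.abs_re_le_norm _).trans ((norm_trace_mul_le_frobNorm S Y).trans
        (mul_le_mul_of_nonneg_right fS hF))
    -- Pairing `X + τ • Y` with the subgradient gives at most its nuclear norm, hence at most that
    -- of `X`; the contribution of `X` itself cancels.
    have h3 : τ * (RCLike.re (S * Y).trace + nuclearNorm Z) ≤ 0 := by linarith
    have h4 := nonpos_of_mul_nonpos_right h3 hτ
    linarith [(abs_le.1 h2).1]
  -- the tangent part
  have hT : nuclearNorm (P * Y + (1 - P) * Y * Q) ≤ √2 * √r * frobNorm Y := by
    refine nuclearNorm_le_iff.2 fun U hU => ?_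
    have h1 : ‖(U * (P * Y)).trace‖ ≤ √r * frobNorm (P * Y) := by
      -- Duplicating the projection lets one copy pay the factor √r in Frobenius norm while the
      -- other stays with `Y`.
      rw [show U * (P * Y) = (U * P) * (P * Y) by
        rw [Matrix.mul_assoc U P, ← Matrix.mul_assoc P P, hPP]]
      refine (norm_trace_mul_le_frobNorm _ _).trans ?_
      refine mul_le_mul_of_nonneg_right ?_ (frobNorm_nonneg _)
      exact (frobNorm_mul_le _ _).trans ((mul_le_of_le_one_left (frobNorm_nonneg _) hU).trans fP)
    have h2 : ‖(U * ((1 - P) * Y * Q)).trace‖ ≤ √r * frobNorm ((1 - P) * Y) := by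
      rw [← Matrix.mul_assoc, Matrix.trace_mul_comm, ← Matrix.mul_assoc]
      refine (norm_trace_mul_le_frobNorm _ _).trans ?_
      refine mul_le_mul_of_nonneg_right ?_ (frobNorm_nonneg _)
      exact (frobNorm_mul_le' _ _).trans ((mul_le_of_le_one_right (frobNorm_nonneg _) hU).trans fQ)
    have h3 := frobNorm_sq_add_of_isIdempotent hP hPP Y
    have h4 : frobNorm (P * Y) + frobNorm ((1 - P) * Y) ≤ √2 * frobNorm Y := by
      refine le_of_pow_le_pow_left₀ two_ne_zero (mul_nonneg (Real.sqrt_nonneg _) hF) ?_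
      rw [mul_pow, Real.sq_sqrt zero_le_two, ← h3]
      nlinarith [sq_nonneg (frobNorm (P * Y) - frobNorm ((1 - P) * Y))]
    rw [Matrix.mul_add, Matrix.trace_add]
    calc _ ≤ √r * frobNorm (P * Y) + √r * frobNorm ((1 - P) * Y) :=
          (norm_add_le _ _).trans (add_le_add h1 h2)
      _ = √r * (frobNorm (P * Y) + frobNorm ((1 - P) * Y)) := by ring
      _ ≤ √r * (√2 * frobNorm Y) := mul_le_mul_of_nonneg_left h4 (Real.sqrt_nonneg _)
      _ = _ := by ring
  have hsplit : Y = (P * Y + (1 - P) * Y * Q) + Z := by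
    rw [hZ]
    simp only [Matrix.mul_sub, Matrix.sub_mul, Matrix.mul_one, Matrix.one_mul]
    abel
  calc nuclearNorm Y ≤ nuclearNorm (P * Y + (1 - P) * Y * Q) + nuclearNorm Z := by
        conv_lhs => rw [hsplit]
        exact nuclearNorm_add_le _ _
    _ ≤ √2 * √r * frobNorm Y + √r * frobNorm Y := add_le_add hT hZle
    _ = _ := by ring

end LinearAlgebra

/-! ### Square norm and comparison of descent cones -/

section SquareNorm

variable {𝕜 : Type*} [RCLike 𝕜] {w v : Type*} [Fintype w] [DecidableEq w]
  [Fintype v]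

lemma isCompact_frobNorm_eq (c : ℝ) : IsCompact {A : Matrix v v 𝕜 | frobNorm A = c} := by
  have h : IsCompact {A : Matrix v v 𝕜 | ∀ i j, A i j ∈ Metric.closedBall (0 : 𝕜) c} :=
    isCompact_pi_infinite fun i => isCompact_pi_infinite fun j => isCompact_closedBall 0 c
  refine h.of_isClosed_subset (isClosed_eq continuous_frobNorm continuous_const) ?_
  intro A hA i j
  rw [mem_closedBall_zero_iff]
  exact (norm_entry_le_frobNorm A i j).trans_eq hA

lemma continuous_kronecker_sandwich (X : Matrix (w × v) (w × v) 𝕜) :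
    Continuous fun p : Matrix v v 𝕜 × Matrix v v 𝕜 =>
      ((1 : Matrix w w 𝕜) ⊗ₖ p.1) * X * ((1 : Matrix w w 𝕜) ⊗ₖ p.2) := by
  have h : ∀ f : Matrix v v 𝕜 × Matrix v v 𝕜 → Matrix v v 𝕜, Continuous f →
      Continuous fun p => (1 : Matrix w w 𝕜) ⊗ₖ f p := by
    intro f hf
    refine continuous_matrix fun i j => ?_
    simp only [Matrix.kroneckerMap_apply]
    fun_prop
  exact ((h _ continuous_fst).matrix_mul continuous_const).matrix_mul (h _ continuous_snd)

variable [DecidableEq v]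

/-- Continuity on a compact set of pairs. Without boundedness the real `sSup` would take its default
value and bound nothing. -/
lemma bddAbove_squareNorm (X : Matrix (w × v) (w × v) 𝕜) :
    BddAbove {t : ℝ | ∃ A B : Matrix v v 𝕜,
      frobNorm A = √(Fintype.card v) ∧ frobNorm B = √(Fintype.card v) ∧
      t = nuclearNorm (((1 : Matrix w w 𝕜) ⊗ₖ A) * X * ((1 : Matrix w w 𝕜) ⊗ₖ B))} := by
  have hc := ((isCompact_frobNorm_eq (𝕜 := 𝕜) (v := v) √(Fintype.card v)).prod
    (isCompact_frobNorm_eq (𝕜 := 𝕜) (v := v) √(Fintype.card v))).bddAbove_image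
    (continuous_nuclearNorm.comp (continuous_kronecker_sandwich X)).continuousOn
  refine hc.mono ?_
  rintro t ⟨A, B, hA, hB, rfl⟩
  exact ⟨(A, B), ⟨hA, hB⟩, rfl⟩

lemma frobNorm_one : frobNorm (1 : Matrix v v 𝕜) = √(Fintype.card v) := by
  simp [frobNorm, Matrix.trace_one]

lemma nuclearNorm_sandwich_le_squareNorm (X : Matrix (w × v) (w × v) 𝕜) {A B : Matrix v v 𝕜}
    (hA : frobNorm A = √(Fintype.card v)) (hB : frobNorm B = √(Fintype.card v)) :
    nuclearNorm (((1 : Matrix w w 𝕜) ⊗ₖ A) * X * ((1 : Matrix w w 𝕜) ⊗ₖ B)) ≤ squareNorm X :=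
  le_csSup (bddAbove_squareNorm X) ⟨A, B, hA, hB, rfl⟩

lemma nuclearNorm_le_squareNorm (X : Matrix (w × v) (w × v) 𝕜) :
    nuclearNorm X ≤ squareNorm X := by
  simpa using nuclearNorm_sandwich_le_squareNorm X (frobNorm_one (𝕜 := 𝕜) (v := v))
    (frobNorm_one (𝕜 := 𝕜) (v := v))

lemma squareNorm_zero : squareNorm (0 : Matrix (w × v) (w × v) 𝕜) = 0 := by
  refine le_antisymm ?_ ((nuclearNorm_nonneg _).trans (nuclearNorm_le_squareNorm _))
  refine csSup_le ⟨_, 1, 1, frobNorm_one, frobNorm_one, rfl⟩ ?_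
  rintro t ⟨A, B, -, -, rfl⟩
  simp [nuclearNorm_zero]

/-- A sublevel set of a supremum is an intersection of closed sublevel sets. This lower
semicontinuity suffices for the existence of minimizers. -/
lemma isClosed_squareNorm_le (c : ℝ) :
    IsClosed {X : Matrix (w × v) (w × v) 𝕜 | squareNorm X ≤ c} := by
  have : {X : Matrix (w × v) (w × v) 𝕜 | squareNorm X ≤ c} =
      ⋂ (A : Matrix v v 𝕜) (_ : frobNorm A = √(Fintype.card v)) (B : Matrix v v 𝕜)
        (_ : frobNorm B = √(Fintype.card v)),
        {X | nuclearNorm (((1 : Matrix w w 𝕜) ⊗ₖ A) * X * ((1 : Matrix w w 𝕜) ⊗ₖ B)) ≤ c} := by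
    ext X
    simp only [Set.mem_ofPred_eq, Set.mem_iInter]
    refine ⟨fun h A hA B hB => (nuclearNorm_sandwich_le_squareNorm X hA hB).trans h, fun h => ?_⟩
    refine csSup_le ⟨_, 1, 1, frobNorm_one, frobNorm_one, rfl⟩ ?_
    rintro t ⟨A, B, hA, hB, rfl⟩
    exact h A hA B hB
  rw [this]
  refine isClosed_iInter fun A => isClosed_iInter fun _ => isClosed_iInter fun B =>
    isClosed_iInter fun _ => isClosed_le (continuous_nuclearNorm.comp ?_) continuous_const
  exact (continuous_const.matrix_mul continuous_id).matrix_mul continuous_const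

/-- A dominating function that touches at `X` has fewer descent directions there: ‖X+τU‖_* ≤
‖X+τU‖_□ ≤ ‖X‖_□ = ‖X‖_*. -/
lemma descentCone_squareNorm_subset {X : Matrix (w × v) (w × v) 𝕜}
    (hX : squareNorm X = nuclearNorm X) :
    descentCone squareNorm X ⊆ descentCone nuclearNorm X := by
  intro U hU
  simp only [descentCone, Set.mem_iUnion, Set.mem_ofPred_eq] at hU ⊢
  obtain ⟨τ, hτ, h⟩ := hU
  exact ⟨τ, hτ, (nuclearNorm_le_squareNorm _).trans (h.trans_eq hX)⟩

lemma coneUnion_squareNorm_subset (L : Submodule ℝ (Matrix (w × v) (w × v) 𝕜)) (r : ℕ) :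
    coneUnion squareNorm L (rankLEExtremal r) ⊆ coneUnion nuclearNorm L (rankLE r) := by
  rintro U ⟨hU, X, hXL, ⟨hXr, hX⟩, hX0, hUX⟩
  exact ⟨hU, X, hXL, hXr, hX0, descentCone_squareNorm_subset hX hUX⟩

end SquareNorm

/-! ### Deterministic recovery from a conic singular value -/

section Recovery

variable {𝕜 : Type*} [RCLike 𝕜] {n : Type*} [Fintype n] {m : ℕ}

lemma measurementMap_sub (A : Fin m → Matrix n n 𝕜) (X Y : Matrix n n 𝕜) :
    measurementMap A (X - Y) = measurementMap A X - measurementMap A Y := by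
  ext i
  simp [measurementMap, Matrix.mul_sub, Matrix.trace_sub]

lemma measurementMap_smul (A : Fin m → Matrix n n 𝕜) (c : ℝ) (X : Matrix n n 𝕜) :
    measurementMap A (c • X) = c • measurementMap A X := by
  ext i
  simp [measurementMap, Matrix.trace_smul]

lemma continuous_measurementMap (A : Fin m → Matrix n n 𝕜) : Continuous (measurementMap A) := by
  unfold measurementMap
  refine (PiLp.continuous_toLp 2 _).comp ?_
  fun_prop

lemma minConicSV_anti (A : Fin m → Matrix n n 𝕜) {K K' : Set (Matrix n n 𝕜)} (h : K ⊆ K') :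
    minConicSV A K' ≤ minConicSV A K :=
  biInf_mono h

lemma le_minConicSV_iff {A : Fin m → Matrix n n 𝕜} {K : Set (Matrix n n 𝕜)} {c : ℝ} :
    ENNReal.ofReal c ≤ minConicSV A K ↔
      ∀ Y ∈ K, Y ≠ 0 → c * frobNorm Y ≤ ‖measurementMap A Y‖ := by
  simp only [minConicSV, le_iInf_iff]
  refine forall₃_congr fun Y _ hY => ?_
  have : 0 < frobNorm Y := (frobNorm_nonneg Y).lt_of_ne' (frobNorm_eq_zero.not.2 hY)
  rw [ENNReal.ofReal_le_ofReal_iff (by positivity), le_div_iff₀ this]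

variable [DecidableEq n]

lemma norm_entry_le_nuclearNorm (X : Matrix n n 𝕜) (i j : n) : ‖X i j‖ ≤ nuclearNorm X :=
  (norm_entry_le_frobNorm X i j).trans (frobNorm_le_nuclearNorm X)

/-- Minimization of a lower semicontinuous function that dominates the nuclear norm has
solutions. -/
theorem exists_isSolution {f : Matrix n n 𝕜 → ℝ} (hf : ∀ c, IsClosed {X | f X ≤ c})
    (hfn : ∀ X, nuclearNorm X ≤ f X) (L : Submodule ℝ (Matrix n n 𝕜))
    (A : Fin m → Matrix n n 𝕜) {y : EuclideanSpace 𝕜 (Fin m)} {η : ℝ} {X₀ : Matrix n n 𝕜}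
    (hX₀ : X₀ ∈ L) (hy : ‖measurementMap A X₀ - y‖ ≤ η) : ∃ X, IsSolution f L A y η X := by
  set F : Set (Matrix n n 𝕜) := {X | X ∈ L ∧ ‖measurementMap A X - y‖ ≤ η} with hF
  have hFc : IsClosed F := by
    refine IsClosed.inter (Submodule.closed_of_finiteDimensional L) ?_
    exact isClosed_le ((continuous_measurementMap A).sub continuous_const).norm continuous_const
  have hb : IsCompact {X : Matrix n n 𝕜 | ∀ i j, X i j ∈ Metric.closedBall (0 : 𝕜) (f X₀)} :=
    isCompact_pi_infinite fun i => isCompact_pi_infinite fun j => isCompact_closedBall 0 _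
  have hc : IsCompact (F ∩ {X | f X ≤ f X₀}) := by
    refine hb.of_isClosed_subset (hFc.inter (hf _)) ?_
    rintro X ⟨-, hX⟩ i j
    rw [mem_closedBall_zero_iff]
    exact (norm_entry_le_nuclearNorm X i j).trans ((hfn X).trans hX)
  have hlsc : LowerSemicontinuous f := lowerSemicontinuous_iff_isClosed_preimage.2 hf
  obtain ⟨X, hX, hmin⟩ := LowerSemicontinuousOn.exists_isMinOn
    (s := F ∩ {X | f X ≤ f X₀}) ⟨X₀, ⟨hX₀, hy⟩, le_refl (f X₀)⟩ hc (hlsc.lowerSemicontinuousOn _)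
  refine ⟨X, hX.1, fun Z hZ hZy => ?_⟩
  rcases le_total (f Z) (f X₀) with h | h
  · exact hmin ⟨⟨hZ, hZy⟩, h⟩
  · exact le_trans hX.2 h

/-- A lower bound for the minimum conic singular value implies stable recovery. -/
theorem stablyRecovers_of_le_minConicSV {f : Matrix n n 𝕜 → ℝ}
    (hf : ∀ c, IsClosed {X | f X ≤ c}) (hfn : ∀ X, nuclearNorm X ≤ f X) (hf0 : f 0 = 0)
    {L : Submodule ℝ (Matrix n n 𝕜)} {S : Set (Matrix n n 𝕜)} {A : Fin m → Matrix n n 𝕜}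
    {c : ℝ} (hc : 0 < c) (hm : 0 < m)
    (h : ENNReal.ofReal (2 * c * √m) ≤ minConicSV A (coneUnion f L S)) :
    StablyRecovers f L S A c := by
  intro X₀ hX₀L hX₀S e η he
  have hη : 0 ≤ η := (norm_nonneg e).trans he
  have hcm : 0 < c * √m := mul_pos hc (Real.sqrt_pos.2 (by exact_mod_cast hm))
  have hX₀ : ‖measurementMap A X₀ - (measurementMap A X₀ + e)‖ ≤ η := by
    rwa [sub_add_cancel_left, norm_neg]
  refine ⟨exists_isSolution hf hfn L A hX₀L hX₀, fun X ⟨⟨hXL, hXη⟩, hmin⟩ => ?_⟩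
  have hle := hmin X₀ hX₀L hX₀
  by_cases hXX : X - X₀ = 0
  · rw [hXX, frobNorm_eq_zero.2 rfl]; positivity
  -- The cones are anchored at nonzero signals only. For the zero signal, feasibility of 0 forces
  -- f(X) ≤ 0, hence X = 0.
  by_cases h0 : X₀ = 0
  · subst h0
    refine absurd ?_ hXX
    rw [sub_zero, ← frobNorm_eq_zero]
    refine le_antisymm ?_ (frobNorm_nonneg X)
    exact (frobNorm_le_nuclearNorm X).trans ((hfn X).trans (hle.trans_eq hf0))
  have hmem : X - X₀ ∈ coneUnion f L S := by
    refine ⟨L.sub_mem hXL hX₀L, X₀, hX₀L, hX₀S, h0, ?_⟩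
    simp only [descentCone, Set.mem_iUnion, Set.mem_ofPred_eq]
    exact ⟨1, one_pos, by rwa [one_smul, add_sub_cancel]⟩
  have h1 := le_minConicSV_iff.1 h _ hmem hXX
  have h2 : ‖measurementMap A (X - X₀)‖ ≤ 2 * η := by
    rw [measurementMap_sub]
    calc _ = ‖(measurementMap A X - (measurementMap A X₀ + e)) -
          (measurementMap A X₀ - (measurementMap A X₀ + e))‖ := by rw [sub_sub_sub_cancel_right]
      _ ≤ η + η := (norm_sub_le _ _).trans (add_le_add hXη hX₀)
      _ = 2 * η := by ring
  rw [le_div_iff₀ hcm]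
  nlinarith

theorem nuclearNorm_stablyRecovers {L : Submodule ℝ (Matrix n n 𝕜)}
    {A : Fin m → Matrix n n 𝕜} {c : ℝ} {r : ℕ} (hc : 0 < c) (hm : 0 < m)
    (h : ENNReal.ofReal (2 * c * √m) ≤ minConicSV A (coneUnion nuclearNorm L (rankLE r))) :
    StablyRecovers nuclearNorm L (rankLE r) A c :=
  stablyRecovers_of_le_minConicSV
    (fun _ => isClosed_le continuous_nuclearNorm continuous_const) (fun _ => le_rfl)
    nuclearNorm_zero hc hm h

theorem squareNorm_stablyRecovers {w v : Type*} [Fintype w] [DecidableEq w]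
    [Fintype v] [DecidableEq v] {L : Submodule ℝ (Matrix (w × v) (w × v) 𝕜)}
    {A : Fin m → Matrix (w × v) (w × v) 𝕜} {c : ℝ} {r : ℕ} (hc : 0 < c) (hm : 0 < m)
    (h : ENNReal.ofReal (2 * c * √m) ≤ minConicSV A (coneUnion nuclearNorm L (rankLE r))) :
    StablyRecovers squareNorm L (rankLEExtremal r) A c :=
  stablyRecovers_of_le_minConicSV isClosed_squareNorm_le nuclearNorm_le_squareNorm
    squareNorm_zero hc hm (h.trans (minConicSV_anti A (coneUnion_squareNorm_subset L r)))

end Recovery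

/-! ### Suprema over signs and the contraction principle -/

section Suprema

variable {ι : Type*}

lemma bddAbove_range_of_abs_le {f : ι → ℝ} {B : ℝ} (h : ∀ i, |f i| ≤ B) :
    BddAbove (Set.range f) :=
  ⟨B, by rintro _ ⟨i, rfl⟩; exact (abs_le.1 (h i)).2⟩

lemma le_ciSup_of_abs_le {f : ι → ℝ} {B : ℝ} (h : ∀ i, |f i| ≤ B) (i : ι) : f i ≤ ⨆ j, f j :=
  le_ciSup (bddAbove_range_of_abs_le h) i

variable [Nonempty ι]

lemma abs_ciSup_le {f : ι → ℝ} {B : ℝ} (h : ∀ i, |f i| ≤ B) : |⨆ i, f i| ≤ B := by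
  obtain ⟨i⟩ := ‹Nonempty ι›
  have : Nonempty ι := ⟨i⟩
  refine abs_le.2 ⟨(abs_le.1 (h i)).1.trans (le_ciSup_of_abs_le h i), ?_⟩
  exact ciSup_le fun j => (abs_le.1 (h j)).2

/-- The contraction principle for a single sign. For a pair (i, j), u i - u j is at most |t i - t
j|, which is t i - t j or t j - t i; in the second case i and j exchange roles on the right. -/
lemma ciSup_add_ciSup_sub_le {h u t : ι → ℝ} {B : ℝ} (hh : ∀ i, |h i| ≤ B)
    (ht : ∀ i, |t i| ≤ B) (hut : ∀ i j, |u i - u j| ≤ |t i - t j|) :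
    (⨆ i, (h i + u i)) + ⨆ i, (h i - u i) ≤ (⨆ i, (h i + t i)) + ⨆ i, (h i - t i) := by
  have h1 : ∀ i, |h i + t i| ≤ B + B := fun i =>
    (abs_add_le _ _).trans (add_le_add (hh i) (ht i))
  have h2 : ∀ i, |h i - t i| ≤ B + B := fun i => (abs_sub _ _).trans (add_le_add (hh i) (ht i))
  rw [← le_sub_iff_add_le]
  refine ciSup_le fun i => ?_
  rw [le_sub_comm]
  refine ciSup_le fun j => ?_
  have a1 := le_ciSup_of_abs_le h1 i
  have a2 := le_ciSup_of_abs_le h2 j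
  have a3 := le_ciSup_of_abs_le h1 j
  have a4 := le_ciSup_of_abs_le h2 i
  have a5 := (le_abs_self _).trans (hut i j)
  rcases abs_cases (t i - t j) with ⟨e, -⟩ | ⟨e, -⟩ <;> rw [e] at a5 <;> linarith

end Suprema

lemma sum_signs_succ {m : ℕ} (f : (Fin (m + 1) → ℤˣ) → ℝ) :
    ∑ ε, f ε = ∑ ε : Fin m → ℤˣ, (f (Fin.cons 1 ε) + f (Fin.cons (-1) ε)) := by
  rw [← (Fin.consEquiv fun _ : Fin (m + 1) => ℤˣ).sum_comp, Fintype.sum_prod_type,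
    UnitsInt.univ, Finset.sum_pair (by decide), ← Finset.sum_add_distrib]
  rfl

lemma abs_sum_signs_le {m : ℕ} (ε : Fin m → ℤˣ) {t : Fin m → ℝ} {B : ℝ} (ht : ∀ k, |t k| ≤ B) :
    |∑ k, ((ε k : ℤ) : ℝ) * t k| ≤ m * B := by
  refine (Finset.abs_sum_le_sum_abs _ _).trans ?_
  refine (Finset.sum_le_card_nsmul _ _ B fun k _ => ?_).trans (by simp)
  rw [abs_mul]
  rcases Int.units_eq_one_or (ε k) with h | h <;> simpa [h] using ht k

/-- The contraction principle for Rademacher sums. -/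
theorem rademacher_contraction {ι : Type*} [Nonempty ι] (m : ℕ) (h : ι → ℝ) (u t : Fin m → ι → ℝ)
    {B : ℝ} (hh : ∀ i, |h i| ≤ B) (hu : ∀ k i, |u k i| ≤ B) (ht : ∀ k i, |t k i| ≤ B)
    (hut : ∀ k i j, |u k i - u k j| ≤ |t k i - t k j|) :
    ∑ ε : Fin m → ℤˣ, (⨆ i, (h i + ∑ k, ((ε k : ℤ) : ℝ) * u k i)) ≤
      ∑ ε : Fin m → ℤˣ, ⨆ i, (h i + ∑ k, ((ε k : ℤ) : ℝ) * t k i) := by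
  -- The offset `h` must be free: the contracted first coordinate is absorbed into it with either
  -- sign. The bound `B` only keeps suprema finite and may grow.
  induction m generalizing h B with
  | zero => simp
  | succ m ih =>
    simp only [sum_signs_succ, Fin.sum_univ_succ, Fin.cons_zero, Fin.cons_succ, Units.val_one,
      Units.val_neg, Int.cast_one, Int.cast_neg, one_mul, neg_mul]
    have hB : 0 ≤ B := (abs_nonneg _).trans (hh (Classical.arbitrary ι))
    have key : ∀ ε : Fin m → ℤˣ,
        ((⨆ i, (h i + (u 0 i + ∑ k : Fin m, ((ε k : ℤ) : ℝ) * u k.succ i))) +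
          ⨆ i, (h i + (-u 0 i + ∑ k : Fin m, ((ε k : ℤ) : ℝ) * u k.succ i))) ≤
        (⨆ i, ((h i + t 0 i) + ∑ k : Fin m, ((ε k : ℤ) : ℝ) * u k.succ i)) +
          ⨆ i, ((h i - t 0 i) + ∑ k : Fin m, ((ε k : ℤ) : ℝ) * u k.succ i) := by
      intro ε
      have := ciSup_add_ciSup_sub_le
        (h := fun i => h i + ∑ k : Fin m, ((ε k : ℤ) : ℝ) * u k.succ i) (u := u 0) (t := t 0)
        (B := B + m * B)
        (fun i => (abs_add_le _ _).trans
          (add_le_add (hh i) (abs_sum_signs_le ε fun k => hu k.succ i)))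
        (fun i => (ht 0 i).trans (le_add_of_nonneg_right (by positivity))) (hut 0)
      refine (le_of_eq ?_).trans (this.trans (le_of_eq ?_)) <;>
        exact congrArg₂ _ (iSup_congr fun i => by ring) (iSup_congr fun i => by ring)
    refine (Finset.sum_le_sum fun ε _ => key ε).trans ?_
    have hB2 : B ≤ B + B := by linarith
    rw [Finset.sum_add_distrib, Finset.sum_add_distrib]
    have i1 := ih (fun i => h i + t 0 i) (fun k => u k.succ) (fun k => t k.succ) (B := B + B)
      (fun i => (abs_add_le _ _).trans (add_le_add (hh i) (ht 0 i)))
      (fun k i => (hu k.succ i).trans hB2) (fun k i => (ht k.succ i).trans hB2)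
      (fun k => hut k.succ)
    have i2 := ih (fun i => h i - t 0 i) (fun k => u k.succ) (fun k => t k.succ) (B := B + B)
      (fun i => (abs_sub _ _).trans (add_le_add (hh i) (ht 0 i)))
      (fun k i => (hu k.succ i).trans hB2) (fun k i => (ht k.succ i).trans hB2)
      (fun k => hut k.succ)
    refine (add_le_add i1 i2).trans (le_of_eq ?_)
    exact congrArg₂ _ (Finset.sum_congr rfl fun ε _ => iSup_congr fun i => by ring)
      (Finset.sum_congr rfl fun ε _ => iSup_congr fun i => by ring)

/-! ### Integration over product measures and bounded differences -/

section Integration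

variable {X : Type*} [MeasurableSpace X]

lemma integrable_of_abs_le {Ω : Type*} [MeasurableSpace Ω] {P : Measure Ω} [IsFiniteMeasure P]
    {f : Ω → ℝ} {B : ℝ} (hf : Measurable f) (h : ∀ x, |f x| ≤ B) : Integrable f P :=
  Integrable.of_bound hf.aestronglyMeasurable B (Filter.Eventually.of_forall fun x => (Real.norm_eq_abs _).trans_le (h x))

lemma abs_integral_le {Ω : Type*} [MeasurableSpace Ω] {P : Measure Ω} [IsProbabilityMeasure P]
    {f : Ω → ℝ} {B : ℝ} (h : ∀ x, |f x| ≤ B) : |∫ x, f x ∂P| ≤ B := by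
  simpa using norm_integral_le_of_norm_le_const (μ := P)
    (Filter.Eventually.of_forall fun x => (Real.norm_eq_abs _).trans_le (h x))

lemma piFinSuccAbove_zero_symm_apply {m : ℕ} (p : X × (Fin m → X)) :
    (MeasurableEquiv.piFinSuccAbove (fun _ : Fin (m + 1) => X) 0).symm p =
      (Fin.cons p.1 p.2 : Fin (m + 1) → X) :=
  Fin.insertNth_zero' p.1 p.2

lemma measurable_cons {m : ℕ} :
    Measurable fun p : X × (Fin m → X) => (Fin.cons p.1 p.2 : Fin (m + 1) → X) := by
  rw [← funext piFinSuccAbove_zero_symm_apply]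
  exact (MeasurableEquiv.piFinSuccAbove (fun _ : Fin (m + 1) => X) 0).symm.measurable

variable (μ : Measure X) [IsProbabilityMeasure μ]

lemma integral_pi_succ {m : ℕ} (F : (Fin (m + 1) → X) → ℝ) :
    ∫ x, F x ∂Measure.pi (fun _ => μ) =
      ∫ p, F (Fin.cons p.1 p.2) ∂(μ.prod (Measure.pi fun _ : Fin m => μ)) := by
  have h := (measurePreserving_piFinSuccAbove (fun _ : Fin (m + 1) => μ) 0).symm
  rw [← h.integral_comp']
  simp only [piFinSuccAbove_zero_symm_apply]

lemma integral_prod_of_abs_le {Y : Type*} [MeasurableSpace Y] (ν : Measure Y)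
    [IsProbabilityMeasure ν] {F : X × Y → ℝ} (hF : Measurable F) {B : ℝ} (hB : ∀ p, |F p| ≤ B) :
    ∫ p, F p ∂μ.prod ν = ∫ y, ∫ x, F (x, y) ∂μ ∂ν :=
  integral_prod_symm _ (integrable_of_abs_le hF hB)

lemma integral_integral_comm_of_abs_le {Y : Type*} [MeasurableSpace Y] (ν : Measure Y)
    [IsProbabilityMeasure ν] {F : X × Y → ℝ} (hF : Measurable F) {B : ℝ} (hB : ∀ p, |F p| ≤ B) :
    ∫ x, ∫ y, F (x, y) ∂ν ∂μ = ∫ y, ∫ x, F (x, y) ∂μ ∂ν :=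
  integral_integral_swap (f := fun x y => F (x, y)) (integrable_of_abs_le hF hB)

lemma measurable_integral_left {Y : Type*} [MeasurableSpace Y] {F : X × Y → ℝ}
    (hF : Measurable F) : Measurable fun y => ∫ x, F (x, y) ∂μ :=
  (hF.stronglyMeasurable.integral_prod_left').measurable

lemma measurable_integral_right {Y : Type*} [MeasurableSpace Y] {F : Y × X → ℝ}
    (hF : Measurable F) : Measurable fun y => ∫ x, F (y, x) ∂μ :=
  (hF.stronglyMeasurable.integral_prod_right').measurable

/-- The bounded differences inequality. -/
theorem hasSubgaussianMGF_of_bounded_differences {c : NNReal} (m : ℕ) (F : (Fin m → X) → ℝ)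
    (hF : Measurable F) {B : ℝ} (hB : ∀ x, |F x| ≤ B)
    (hc : ∀ x i y, |F x - F (Function.update x i y)| ≤ c) :
    HasSubgaussianMGF (fun x => F x - ∫ y, F y ∂Measure.pi fun _ => μ) (m * c ^ 2)
      (Measure.pi fun _ => μ) := by
  have hint : ∀ {k : ℕ} (F : (Fin k → X) → ℝ), Measurable F → (∀ x, |F x| ≤ B) → ∀ M t : ℝ,
      Integrable (fun x => Real.exp (t * (F x - M))) (Measure.pi fun _ => μ) := by
    intro k F hF hB M t
    refine integrable_exp_mul_of_mem_Icc (a := -B - M) (b := B - M)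
      (hF.sub_const _).aemeasurable ?_
    refine Filter.Eventually.of_forall fun x => ⟨?_, ?_⟩ <;> linarith [abs_le.1 (hB x)]
  refine ⟨hint F hF hB _, fun t => ?_⟩
  simp only [mgf]
  induction m with
  | zero =>
    have : ∀ x, F x - ∫ y, F y ∂Measure.pi (fun _ : Fin 0 => μ) = 0 := by
      intro x
      have : ∀ y, F y = F x := fun y => by rw [Subsingleton.elim y x]
      simp [this]
    simp [this]
  | succ m ih =>
    have hFc : Measurable fun p : X × (Fin m → X) => F (Fin.cons p.1 p.2) :=
      hF.comp measurable_cons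
    -- Averaging out the first coordinate keeps the bounded differences and the mean, so `G` falls
    -- under the induction hypothesis.
    set G : (Fin m → X) → ℝ := fun x => ∫ a, F (Fin.cons a x) ∂μ with hG
    have hGm : Measurable G := measurable_integral_left μ hFc
    have hGB : ∀ x, |G x| ≤ B := fun x => abs_integral_le fun a => hB _
    have hsec : ∀ x, Measurable fun a => F (Fin.cons a x) := fun x =>
      hFc.comp measurable_prodMk_right
    have hGc : ∀ x i y, |G x - G (Function.update x i y)| ≤ c := by
      intro x i y
      simp only [hG]
      rw [← integral_sub (integrable_of_abs_le (hsec x) fun a => hB _)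
        (integrable_of_abs_le (hsec _) fun a => hB _)]
      refine abs_integral_le fun a => ?_
      rw [Fin.cons_update]
      exact hc _ _ _
    have hmean : ∫ y, F y ∂Measure.pi (fun _ : Fin (m + 1) => μ) =
        ∫ y, G y ∂Measure.pi (fun _ : Fin m => μ) := by
      rw [integral_pi_succ, integral_prod_of_abs_le _ _ hFc fun p => hB _]
    set M := ∫ y, G y ∂Measure.pi (fun _ : Fin m => μ) with hM
    have hinner : ∀ x, ∫ a, Real.exp (t * (F (Fin.cons a x) - M)) ∂μ ≤
        Real.exp (c ^ 2 * t ^ 2 / 2) * Real.exp (t * (G x - M)) := by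
      intro x
      obtain ⟨a₀⟩ : Nonempty X := nonempty_of_isProbabilityMeasure μ
      -- Each section stays within `c` of its value at a reference point. Hoeffding's lemma on this
      -- interval of length 2c gives variance proxy c² per coordinate.
      have hsub := hasSubgaussianMGF_of_mem_Icc (μ := μ) (X := fun a => F (Fin.cons a x))
        (a := F (Fin.cons a₀ x) - c) (b := F (Fin.cons a₀ x) + c) (hsec x).aemeasurable
        (Filter.Eventually.of_forall fun a => by
          have := hc (Fin.cons a x) 0 a₀
          rw [Fin.update_cons_zero] at this
          constructor <;> linarith [abs_le.1 this])
      have hpar : (‖(F (Fin.cons a₀ x) + c) - (F (Fin.cons a₀ x) - c)‖₊ / 2) ^ 2 = c ^ 2 := by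
        congr 1
        apply NNReal.eq
        rw [NNReal.coe_div, coe_nnnorm, Real.norm_eq_abs, abs_of_nonneg] <;>
          ring_nf <;> simp
      rw [hpar] at hsub
      have h1 := hsub.mgf_le t
      simp only [mgf, NNReal.coe_pow] at h1
      have h2 : ∀ a, Real.exp (t * (F (Fin.cons a x) - M)) =
          Real.exp (t * (F (Fin.cons a x) - G x)) * Real.exp (t * (G x - M)) := by
        intro a; rw [← Real.exp_add]; congr 1; ring
      simp only [h2]
      rw [integral_mul_const]
      exact mul_le_mul_of_nonneg_right h1 (Real.exp_nonneg _)
    have hexp : Measurable fun p : X × (Fin m → X) =>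
        Real.exp (t * (F (Fin.cons p.1 p.2) - M)) :=
      Real.measurable_exp.comp ((hFc.sub_const M).const_mul t)
    have hexpB : ∀ p : X × (Fin m → X), |Real.exp (t * (F (Fin.cons p.1 p.2) - M))| ≤
        Real.exp (|t| * (B + |M|)) := by
      intro p
      rw [abs_of_pos (Real.exp_pos _)]
      apply Real.exp_le_exp.2
      refine (le_abs_self _).trans ?_
      rw [abs_mul]
      exact mul_le_mul_of_nonneg_left ((abs_sub _ _).trans (by gcongr; exact hB _)) (abs_nonneg t)
    rw [hmean, integral_pi_succ, integral_prod_of_abs_le _ _ hexp hexpB]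
    calc _ ≤ ∫ x, Real.exp (c ^ 2 * t ^ 2 / 2) * Real.exp (t * (G x - M))
          ∂Measure.pi (fun _ : Fin m => μ) := by
          refine integral_mono ?_ ((hint G hGm hGB M t).const_mul _) hinner
          exact integrable_of_abs_le (measurable_integral_left μ hexp)
            fun x => abs_integral_le fun a => hexpB (a, x)
      _ ≤ Real.exp (c ^ 2 * t ^ 2 / 2) * Real.exp (((m * c ^ 2 : NNReal) : ℝ) * t ^ 2 / 2) := by
          rw [integral_const_mul]
          exact mul_le_mul_of_nonneg_left (ih G hGm hGB hGc) (Real.exp_nonneg _)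
      _ = _ := by
          rw [← Real.exp_add]; congr 1; push_cast; ring

end Integration

/-! ### Symmetrization, one coordinate at a time -/

section Symmetrization

variable {X : Type*} [MeasurableSpace X] (μ : Measure X) [IsProbabilityMeasure μ]
  {ι : Type*} [Nonempty ι] [Countable ι]

/-- No ghost sample is needed: 2(h + 𝔼φ - φ(x)) = (h + 2𝔼φ) + (h - 2φ(x)), and the supremum of an
expectation is at most the expectation of the supremum. -/
lemma symmetrization_one {φ : ι → X → ℝ} (hφ : ∀ i, Measurable (φ i)) {B : ℝ}
    (hφB : ∀ i x, |φ i x| ≤ B) {h : ι → ℝ} {C : ℝ} (hh : ∀ i, |h i| ≤ C) :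
    2 * ∫ x, (⨆ i, (h i + (∫ y, φ i y ∂μ - φ i x))) ∂μ ≤
      (∫ x, (⨆ i, (h i + 2 * φ i x)) ∂μ) + ∫ x, (⨆ i, (h i - 2 * φ i x)) ∂μ := by
  have b1 : ∀ x i, |h i + 2 * φ i x| ≤ C + 2 * B := fun x i =>
    (abs_add_le _ _).trans (add_le_add (hh i) (by rw [abs_mul, abs_two]; linarith [hφB i x]))
  have b2 : ∀ x i, |h i - 2 * φ i x| ≤ C + 2 * B := fun x i =>
    (abs_sub _ _).trans (add_le_add (hh i) (by rw [abs_mul, abs_two]; linarith [hφB i x]))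
  have b3 : ∀ x i, |h i + (∫ y, φ i y ∂μ - φ i x)| ≤ C + (B + B) := fun x i =>
    (abs_add_le _ _).trans (add_le_add (hh i) ((abs_sub _ _).trans
      (add_le_add (abs_integral_le (hφB i)) (hφB i x))))
  have m1 : Measurable fun x => ⨆ i, (h i + 2 * φ i x) := by fun_prop
  have m2 : Measurable fun x => ⨆ i, (h i - 2 * φ i x) := by fun_prop
  have m3 : Measurable fun x => ⨆ i, (h i + (∫ y, φ i y ∂μ - φ i x)) := by fun_prop
  have i1 := integrable_of_abs_le (P := μ) m1 fun x => abs_ciSup_le (b1 x)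
  have i2 := integrable_of_abs_le (P := μ) m2 fun x => abs_ciSup_le (b2 x)
  have i3 := integrable_of_abs_le (P := μ) m3 fun x => abs_ciSup_le (b3 x)
  have key : ∀ x, 2 * (⨆ i, (h i + (∫ y, φ i y ∂μ - φ i x))) ≤
      (∫ y, (⨆ i, (h i + 2 * φ i y)) ∂μ) + ⨆ i, (h i - 2 * φ i x) := by
    intro x
    rw [← le_div_iff₀' zero_lt_two]
    refine ciSup_le fun i => ?_
    have h1 : h i + 2 * ∫ y, φ i y ∂μ ≤ ∫ y, (⨆ i, (h i + 2 * φ i y)) ∂μ := by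
      have e : h i + 2 * ∫ y, φ i y ∂μ = ∫ y, (h i + 2 * φ i y) ∂μ := by
        rw [integral_add (integrable_const _)
          ((integrable_of_abs_le (hφ i) (hφB i)).const_mul 2), integral_const_mul]
        simp
      rw [e]
      refine integral_mono ((integrable_const _).add
        ((integrable_of_abs_le (hφ i) (hφB i)).const_mul 2)) i1 fun y => ?_
      exact le_ciSup_of_abs_le (b1 y) i
    have h2 := le_ciSup_of_abs_le (b2 x) i
    linarith
  calc _ = ∫ x, 2 * (⨆ i, (h i + (∫ y, φ i y ∂μ - φ i x))) ∂μ := by rw [integral_const_mul]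
    _ ≤ ∫ x, ((∫ y, (⨆ i, (h i + 2 * φ i y)) ∂μ) + ⨆ i, (h i - 2 * φ i x)) ∂μ :=
      integral_mono (i3.const_mul 2) ((integrable_const _).add i2) key
    _ = _ := by rw [integral_add (integrable_const _) i2]; simp

/-- Symmetrization of the one-sided empirical process. -/
theorem symmetrization (m : ℕ) {φ : ι → X → ℝ} (hφ : ∀ i, Measurable (φ i)) {B : ℝ}
    (hφB : ∀ i x, |φ i x| ≤ B) {h : ι → ℝ} {C : ℝ} (hh : ∀ i, |h i| ≤ C) :
    2 ^ m * ∫ x : Fin m → X, (⨆ i, (h i + ∑ k, (∫ y, φ i y ∂μ - φ i (x k))))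
        ∂Measure.pi (fun _ => μ) ≤
      ∑ ε : Fin m → ℤˣ, ∫ x : Fin m → X,
        (⨆ i, (h i + ∑ k, ((ε k : ℤ) : ℝ) * (2 * φ i (x k)))) ∂Measure.pi (fun _ => μ) := by
  induction m generalizing h C with
  | zero => simp
  | succ m ih =>
    set π := Measure.pi fun _ : Fin m => μ with hπ
    have hφ2 : ∀ i x, |2 * φ i x| ≤ 2 * B := fun i x => by
      rw [abs_mul, abs_two]; linarith [hφB i x]
    have hd : ∀ i a, |∫ y, φ i y ∂μ - φ i a| ≤ 2 * B := fun i a =>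
      (abs_sub _ _).trans (by linarith [abs_integral_le (hφB i) (P := μ), hφB i a])
    have hS : ∀ (i : ι) (x : Fin m → X), |∑ k, (∫ y, φ i y ∂μ - φ i (x k))| ≤ m * (2 * B) := by
      intro i x
      refine (Finset.abs_sum_le_sum_abs _ _).trans ?_
      exact (Finset.sum_le_card_nsmul _ _ _ fun k _ => hd i (x k)).trans (by simp)
    have hε : ∀ (ε : Fin m → ℤˣ) (i : ι) (x : Fin m → X),
        |∑ k, ((ε k : ℤ) : ℝ) * (2 * φ i (x k))| ≤ m * (2 * B) := fun ε i x =>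
      abs_sum_signs_le ε fun k => hφ2 i (x k)
    -- the left-hand side as an iterated integral
    have hL : ∫ x : Fin (m + 1) → X, (⨆ i, (h i + ∑ k, (∫ y, φ i y ∂μ - φ i (x k))))
        ∂Measure.pi (fun _ => μ) = ∫ a, ∫ x, (⨆ i, ((h i + (∫ y, φ i y ∂μ - φ i a)) +
          ∑ k, (∫ y, φ i y ∂μ - φ i (x k)))) ∂π ∂μ := by
      rw [integral_pi_succ]
      simp only [Fin.sum_univ_succ, Fin.cons_zero, Fin.cons_succ, ← add_assoc]
      refine integral_prod _ (integrable_of_abs_le (by fun_prop)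
        (B := C + 2 * B + m * (2 * B)) fun p => abs_ciSup_le fun i => ?_)
      exact (abs_add_le _ _).trans (add_le_add ((abs_add_le _ _).trans
        (add_le_add (hh i) (hd i _))) (hS i _))
    have hR : ∀ ε : Fin m → ℤˣ, ∀ s : ℝ, |s| = 1 →
        ∫ p, (⨆ i, (h i + (s * (2 * φ i p.1) + ∑ k, ((ε k : ℤ) : ℝ) * (2 * φ i (p.2 k)))))
          ∂μ.prod π =
        ∫ x, ∫ a, (⨆ i, ((h i + ∑ k, ((ε k : ℤ) : ℝ) * (2 * φ i (x k))) + s * (2 * φ i a))) ∂μ ∂π := by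
      intro ε s hs
      rw [integral_prod_of_abs_le μ π (by fun_prop) (B := C + (2 * B + m * (2 * B)))]
      · simp only [add_comm, add_left_comm]
      · refine fun p => abs_ciSup_le fun i => (abs_add_le _ _).trans (add_le_add (hh i)
          ((abs_add_le _ _).trans (add_le_add ?_ (hε ε i _))))
        rw [abs_mul, hs, one_mul]; exact hφ2 i _
    -- With the first sample point frozen, its centred term joins the offset. The other coordinates
    -- are symmetrized first, and the one-variable inequality then treats this one.
    have hIH := fun a => ih (h := fun i => h i + (∫ y, φ i y ∂μ - φ i a)) (C := C + 2 * B)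
      fun i => (abs_add_le _ _).trans (add_le_add (hh i) (hd i a))
    have bJ : ∀ (ε : Fin m → ℤˣ) (p : X × (Fin m → X)),
        |⨆ i, ((h i + (∫ y, φ i y ∂μ - φ i p.1)) + ∑ k, ((ε k : ℤ) : ℝ) * (2 * φ i (p.2 k)))| ≤
          C + 2 * B + m * (2 * B) := fun ε p => abs_ciSup_le fun i =>
      (abs_add_le _ _).trans (add_le_add ((abs_add_le _ _).trans
        (add_le_add (hh i) (hd i _))) (hε ε i _))
    have mJ : ∀ ε : Fin m → ℤˣ, Measurable fun p : X × (Fin m → X) =>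
        ⨆ i, ((h i + (∫ y, φ i y ∂μ - φ i p.1)) + ∑ k, ((ε k : ℤ) : ℝ) * (2 * φ i (p.2 k))) :=
      fun ε => by fun_prop
    have iJ : ∀ ε : Fin m → ℤˣ, Integrable (fun a => ∫ x : Fin m → X,
        (⨆ i, ((h i + (∫ y, φ i y ∂μ - φ i a)) + ∑ k, ((ε k : ℤ) : ℝ) * (2 * φ i (x k)))) ∂π) μ :=
      fun ε => integrable_of_abs_le (measurable_integral_right π (mJ ε))
        fun a => abs_integral_le fun x => bJ ε (a, x)
    rw [hL, sum_signs_succ]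
    simp only [integral_pi_succ μ (m := m), Fin.sum_univ_succ, Fin.cons_zero, Fin.cons_succ]
    rw [pow_succ, mul_comm _ (2 : ℝ), mul_assoc, ← integral_const_mul]
    calc _ ≤ 2 * ∫ a, ∑ ε : Fin m → ℤˣ, ∫ x : Fin m → X,
          (⨆ i, ((h i + (∫ y, φ i y ∂μ - φ i a)) + ∑ k, ((ε k : ℤ) : ℝ) * (2 * φ i (x k)))) ∂π
            ∂μ := by
          refine mul_le_mul_of_nonneg_left (integral_mono ?_ ?_ hIH) zero_le_two
          · refine Integrable.const_mul ?_ _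
            refine integrable_of_abs_le (B := C + 2 * B + m * (2 * B))
              (measurable_integral_right π
              (F := fun p : X × (Fin m → X) => ⨆ i, ((h i + (∫ y, φ i y ∂μ - φ i p.1)) +
                ∑ k, (∫ y, φ i y ∂μ - φ i (p.2 k)))) (by fun_prop)) fun a => ?_
            exact abs_integral_le fun x => abs_ciSup_le fun i => (abs_add_le _ _).trans
              (add_le_add ((abs_add_le _ _).trans (add_le_add (hh i) (hd i _))) (hS i _))
          · exact integrable_finsetSum _ fun ε _ => iJ ε
      _ = ∑ ε : Fin m → ℤˣ, 2 * ∫ x : Fin m → X, ∫ a,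
          (⨆ i, ((h i + (∫ y, φ i y ∂μ - φ i a)) + ∑ k, ((ε k : ℤ) : ℝ) * (2 * φ i (x k)))) ∂μ
            ∂π := by
          rw [integral_finsetSum _ fun ε _ => iJ ε, Finset.mul_sum]
          refine Finset.sum_congr rfl fun ε _ => ?_
          rw [integral_integral_comm_of_abs_le μ π (mJ ε) (bJ ε)]
      _ ≤ _ := by
          refine Finset.sum_le_sum fun ε _ => ?_
          have e1 := hR ε 1 (by simp)
          have e2 := hR ε (-1) (by simp)
          simp only [Units.val_one, Units.val_neg, Int.cast_one, Int.cast_neg]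
          rw [e1, e2, ← integral_const_mul]
          have bd : ∀ s : ℝ, |s| = 1 → ∀ p : X × (Fin m → X),
              |⨆ i, ((h i + ∑ k, ((ε k : ℤ) : ℝ) * (2 * φ i (p.2 k))) + s * (2 * φ i p.1))| ≤
                C + m * (2 * B) + 2 * B := by
            intro s hs p
            refine abs_ciSup_le fun i => (abs_add_le _ _).trans (add_le_add ((abs_add_le _ _).trans
              (add_le_add (hh i) (hε ε i _))) ?_)
            rw [abs_mul, hs, one_mul]; exact hφ2 i _
          have ib : ∀ s : ℝ, |s| = 1 → Integrable (fun x : Fin m → X => ∫ a,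
              (⨆ i, ((h i + ∑ k, ((ε k : ℤ) : ℝ) * (2 * φ i (x k))) + s * (2 * φ i a))) ∂μ) π := by
            intro s hs
            refine integrable_of_abs_le (measurable_integral_left μ
              (F := fun p : X × (Fin m → X) => ⨆ i, ((h i +
                ∑ k, ((ε k : ℤ) : ℝ) * (2 * φ i (p.2 k))) + s * (2 * φ i p.1))) (by fun_prop))
              fun x => abs_integral_le fun a => bd s hs (a, x)
          rw [← integral_add (ib 1 (by simp)) (ib (-1) (by simp))]
          refine integral_mono ?_ ((ib 1 (by simp)).add (ib (-1) (by simp))) fun x => ?_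
          · refine Integrable.const_mul ?_ _
            exact integrable_of_abs_le (measurable_integral_left μ (mJ ε))
              fun x => abs_integral_le fun a => bJ ε (a, x)
          · have := symmetrization_one μ hφ hφB
              (h := fun i => h i + ∑ k, ((ε k : ℤ) : ℝ) * (2 * φ i (x k))) (C := C + m * (2 * B))
              fun i => (abs_add_le _ _).trans (add_le_add (hh i) (hε ε i _))
            simp only [one_mul, neg_mul, ← sub_eq_add_neg]
            refine le_trans (le_of_eq ?_) this
            simp only [add_right_comm]

end Symmetrization

/-! ### Uniform lower tail of a bounded empirical process -/

section EmpiricalProcess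

variable {X : Type*} [MeasurableSpace X] (μ : Measure X) [IsProbabilityMeasure μ]
  {ι : Type*} [Nonempty ι]

lemma abs_ciSup_sub_ciSup_le {f g : ι → ℝ} {B c : ℝ} (hf : ∀ i, |f i| ≤ B) (hg : ∀ i, |g i| ≤ B)
    (h : ∀ i, |f i - g i| ≤ c) : |(⨆ i, f i) - ⨆ i, g i| ≤ c := by
  rw [abs_sub_le_iff]
  constructor
  · rw [sub_le_iff_le_add]
    refine ciSup_le fun i => ?_
    linarith [le_ciSup_of_abs_le hg i, abs_le.1 (h i)]
  · rw [sub_le_iff_le_add]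
    refine ciSup_le fun i => ?_
    linarith [le_ciSup_of_abs_le hf i, abs_le.1 (h i)]

variable [Countable ι]

/-- Uniform lower tail bound for a nonnegative bounded empirical process in terms of its
Rademacher complexity. -/
theorem exists_uniform_lower_bound (m : ℕ) {φ : ι → X → ℝ} (hφ : ∀ i, Measurable (φ i))
    {b : NNReal} (hφ0 : ∀ i x, 0 ≤ φ i x) (hφb : ∀ i x, φ i x ≤ b) {W s : ℝ} (hs : 0 ≤ s)
    (hW : ∑ ε : Fin m → ℤˣ, ∫ x : Fin m → X,
        (⨆ i, (0 + ∑ k, ((ε k : ℤ) : ℝ) * (2 * φ i (x k)))) ∂Measure.pi (fun _ => μ) ≤ 2 ^ m * W) :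
    ∃ G : Set (Fin m → X), MeasurableSet G ∧
      ENNReal.ofReal (1 - Real.exp (-s ^ 2 / (2 * (m * b ^ 2)))) ≤
        Measure.pi (fun _ => μ) G ∧
      ∀ x ∈ G, ∀ i, m * ∫ y, φ i y ∂μ - W - s ≤ ∑ k, φ i (x k) := by
  have hφB : ∀ i x, |φ i x| ≤ b := fun i x => by rw [abs_of_nonneg (hφ0 i x)]; exact hφb i x
  set π := Measure.pi fun _ : Fin m => μ with hπ
  set F : (Fin m → X) → ℝ := fun x => ⨆ i, (0 + ∑ k, (∫ y, φ i y ∂μ - φ i (x k))) with hF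
  have hFm : Measurable F := by fun_prop
  have hbd : ∀ (x : Fin m → X) (i : ι), |0 + ∑ k : Fin m, (∫ y, φ i y ∂μ - φ i (x k))| ≤ m * (b + b) := by
    intro x i
    rw [zero_add]
    refine (Finset.abs_sum_le_sum_abs _ _).trans ?_
    refine (Finset.sum_le_card_nsmul _ _ (b + b : ℝ) fun k _ => ?_).trans
      (by rw [Finset.card_univ, Fintype.card_fin, nsmul_eq_mul])
    exact (abs_sub _ _).trans (add_le_add (abs_integral_le (hφB i)) (hφB i _))
  have hFB : ∀ x, |F x| ≤ m * (b + b) := fun x => abs_ciSup_le (hbd x)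
  -- Replacing one sample changes one summand, by at most `b` because `φ` takes values in [0, b].
  have hFc : ∀ x j y, |F x - F (Function.update x j y)| ≤ b := by
    intro x j y
    refine abs_ciSup_sub_ciSup_le (hbd _) (hbd _) fun i => ?_
    rw [add_sub_add_left_eq_sub, ← Finset.sum_sub_distrib,
      Finset.sum_eq_single j (fun k _ hk => by simp [hk]) (by simp)]
    simp only [Function.update_self, sub_sub_sub_cancel_left]
    rw [abs_le]
    constructor <;> linarith [hφ0 i (x j), hφ0 i y, hφb i (x j), hφb i y]
  have hsub := hasSubgaussianMGF_of_bounded_differences μ m F hFm hFB hFc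
  have hmean : ∫ x, F x ∂π ≤ W := by
    have h2 : (0 : ℝ) < 2 ^ m := by positivity
    refine le_of_mul_le_mul_left ?_ h2
    exact (symmetrization μ m hφ hφB (h := fun _ => 0) (C := 0) (by simp)).trans hW
  have htail := hsub.measure_ge_le hs
  have hmeas : MeasurableSet {x | s ≤ F x - ∫ y, F y ∂π} :=
    measurableSet_le measurable_const (hFm.sub_const _)
  refine ⟨{x | s ≤ F x - ∫ y, F y ∂π}ᶜ, hmeas.compl, ?_, fun x hx i => ?_⟩
  · rw [← ofReal_measureReal, probReal_compl_eq_one_sub hmeas]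
    refine ENNReal.ofReal_le_ofReal (sub_le_sub_left ?_ 1)
    simpa using htail
  · have h1 : F x - ∫ y, F y ∂π < s := not_le.1 hx
    have h2 : 0 + ∑ k : Fin m, (∫ y, φ i y ∂μ - φ i (x k)) ≤ F x :=
      le_ciSup_of_abs_le (hbd x) i
    simp only [Finset.sum_sub_distrib, Finset.sum_const, Finset.card_univ, Fintype.card_fin,
      nsmul_eq_mul] at h2
    linarith

/-- Finiteness of the extended integral supplies the integrability of `g`, so the width hypothesis
needs no separate moment assumption. -/
lemma integral_le_of_lintegral_le {Ω : Type*} [MeasurableSpace Ω] {P : Measure Ω} {f g : Ω → ℝ}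
    {V : ℝ} (hf : Integrable f P) (hg : Measurable g) (hg0 : ∀ x, 0 ≤ g x)
    (hfg : ∀ x, f x ≤ g x) (hV : 0 ≤ V) (h : ∫⁻ x, ENNReal.ofReal (g x) ∂P ≤ ENNReal.ofReal V) :
    ∫ x, f x ∂P ≤ V := by
  have hgi : Integrable g P := by
    refine ⟨hg.aestronglyMeasurable, ?_⟩
    rw [hasFiniteIntegral_iff_ofReal (Filter.Eventually.of_forall hg0)]
    exact h.trans_lt ENNReal.ofReal_lt_top
  refine (integral_mono hf hgi hfg).trans ?_
  rw [integral_eq_lintegral_of_nonneg_ae (Filter.Eventually.of_forall hg0)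
    hg.aestronglyMeasurable]
  exact ENNReal.toReal_le_of_le_ofReal hV h

end EmpiricalProcess

/-! ### A Lipschitz truncation for real and complex values -/

section Clipping

lemma abs_clip_sub_clip_le (b s t : ℝ) : |min |s| b - min |t| b| ≤ |s - t| := by
  refine (abs_min_sub_min_le_max _ _ _ _).trans ?_
  rw [sub_self, abs_zero]
  exact max_le (abs_abs_sub_abs_le s t) (abs_nonneg _)

variable {𝕜 : Type*} [RCLike 𝕜]

/-- Average of the clipped moduli of real and imaginary part. -/
def clip (b : ℝ) (z : 𝕜) : ℝ := (min |RCLike.re z| b + min |RCLike.im z| b) / 2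

lemma continuous_clip (b : ℝ) : Continuous (clip b : 𝕜 → ℝ) := by
  unfold clip
  fun_prop

lemma clip_nonneg {b : ℝ} (hb : 0 ≤ b) (z : 𝕜) : 0 ≤ clip b z := by
  unfold clip; positivity

lemma clip_le {b : ℝ} (z : 𝕜) : clip b z ≤ b := by
  unfold clip
  linarith [min_le_right |RCLike.re z| b, min_le_right |RCLike.im z| b]

lemma clip_le_norm {b : ℝ} (z : 𝕜) : clip b z ≤ ‖z‖ := by
  unfold clip
  linarith [min_le_left |RCLike.re z| b, min_le_left |RCLike.im z| b, RCLike.abs_re_le_norm z,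
    RCLike.abs_im_le_norm z]

/-- Either some part reaches the cap 2ξ, or both are uncapped and their sum is at least ‖z‖ ≥ 2ξ.
Averaging the two parts leaves ξ; this is why the small ball condition is placed at 2ξ. -/
lemma le_clip {ξ : ℝ} (hξ : 0 ≤ ξ) {z : 𝕜} (hz : 2 * ξ ≤ ‖z‖) : ξ ≤ clip (2 * ξ) z := by
  have h : ‖z‖ ≤ |RCLike.re z| + |RCLike.im z| := by
    refine le_of_pow_le_pow_left₀ two_ne_zero (by positivity) ?_
    rw [RCLike.norm_sq_eq_def, add_sq, sq_abs, sq_abs]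
    nlinarith [mul_nonneg (abs_nonneg (RCLike.re z)) (abs_nonneg (RCLike.im z))]
  unfold clip
  have h1 := abs_nonneg (RCLike.re z)
  have h2 := abs_nonneg (RCLike.im z)
  rcases min_cases |RCLike.re z| (2 * ξ) with ⟨e, -⟩ | ⟨e, -⟩ <;>
  rcases min_cases |RCLike.im z| (2 * ξ) with ⟨e', -⟩ | ⟨e', -⟩ <;> rw [e, e'] <;> linarith

end Clipping

/-! ### From the ensemble criteria to the conic singular value -/

section Ensembles

variable {𝕜 : Type*} [RCLike 𝕜] {n : Type*} {m : ℕ}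

lemma smul_mem_coneUnion {f : Matrix n n 𝕜 → ℝ} {L : Submodule ℝ (Matrix n n 𝕜)}
    {S : Set (Matrix n n 𝕜)} {Y : Matrix n n 𝕜} (hY : Y ∈ coneUnion f L S) {c : ℝ} (hc : 0 < c) :
    c • Y ∈ coneUnion f L S := by
  obtain ⟨hYL, X, hXL, hXS, hX0, hYX⟩ := hY
  refine ⟨L.smul_mem c hYL, X, hXL, hXS, hX0, ?_⟩
  simp only [descentCone, Set.mem_iUnion, Set.mem_ofPred_eq] at hYX ⊢
  obtain ⟨τ, hτ, h⟩ := hYX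
  refine ⟨τ / c, div_pos hτ hc, ?_⟩
  rwa [smul_smul, div_mul_cancel₀ _ hc.ne']

lemma IsIIDSample.map_eq {Ω : Type*} [MeasurableSpace Ω] {P : Measure Ω}
    [IsProbabilityMeasure P]
    {ν : Measure (Matrix n n 𝕜)} {A : Fin m → Ω → Matrix n n 𝕜} (h : IsIIDSample P ν A) :
    P.map (fun ω k => A k ω) = Measure.pi fun _ => ν := by
  rw [(iIndepFun_iff_map_fun_eq_pi_map fun i => (h.measurable i).aemeasurable).1 h.indep]
  congr 1
  ext1 i
  exact h.law i

variable [Fintype n]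

/-- Makes continuous functions of several matrices measurable for the product σ-algebra, and subsets
of the matrix space separable. -/
instance instSecondCountableTopologyMatrix :
    SecondCountableTopology (Matrix n n 𝕜) :=
  inferInstanceAs (SecondCountableTopology (n → n → 𝕜))

lemma trace_signed_sum_mul (ε : Fin m → ℤˣ) (x : Fin m → Matrix n n 𝕜) (Y : Matrix n n 𝕜) :
    ((∑ k, ((ε k : ℤ) : ℝ) • x k) * Y).trace = ∑ k, ((ε k : ℤ) : ℝ) • (x k * Y).trace := by
  simp [Finset.sum_mul, Matrix.trace_sum]

lemma measurable_clip_trace (b : ℝ) (Y : Matrix n n 𝕜) :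
    Measurable fun x : Matrix n n 𝕜 => clip b (x * Y).trace := by
  refine Continuous.measurable ((continuous_clip b).comp ?_)
  fun_prop

lemma sum_norm_trace_le (x : Fin m → Matrix n n 𝕜) (Y : Matrix n n 𝕜) :
    ∑ k, ‖(x k * Y).trace‖ ≤ √m * ‖measurementMap x Y‖ := by
  have h := sq_sum_le_card_mul_sum_sq (s := Finset.univ) (f := fun k => ‖(x k * Y).trace‖)
  rw [Finset.card_univ, Fintype.card_fin] at h
  have e : ‖measurementMap x Y‖ ^ 2 = ∑ k, ‖(x k * Y).trace‖ ^ 2 := by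
    rw [EuclideanSpace.norm_sq_eq]; rfl
  refine le_of_pow_le_pow_left₀ two_ne_zero (by positivity) ?_
  rwa [mul_pow, Real.sq_sqrt (Nat.cast_nonneg m), e]

/-- Integrate the pointwise bound of the truncation from below by ξ times the indicator of the small
ball event. -/
lemma le_integral_clip {ν : Measure (Matrix n n 𝕜)} [IsProbabilityMeasure ν] {ξ C : ℝ}
    (hξ : 0 ≤ ξ) {Y : Matrix n n 𝕜}
    (h : ENNReal.ofReal C ≤ ν {x | 2 * ξ ≤ ‖(x * Y).trace‖}) :
    ξ * C ≤ ∫ x, clip (2 * ξ) (x * Y).trace ∂ν := by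
  have hS : MeasurableSet {x : Matrix n n 𝕜 | 2 * ξ ≤ ‖(x * Y).trace‖} :=
    (isClosed_le continuous_const (by fun_prop)).measurableSet
  have hC : C ≤ ν.real {x | 2 * ξ ≤ ‖(x * Y).trace‖} :=
    (ENNReal.ofReal_le_iff_le_toReal (measure_ne_top _ _)).1 h
  have h2 : (0 : ℝ) ≤ 2 * ξ := by positivity
  have hi : Integrable (fun x => clip (2 * ξ) (x * Y).trace) ν :=
    integrable_of_abs_le (measurable_clip_trace _ Y) (B := 2 * ξ) fun x => by
      rw [abs_of_nonneg (clip_nonneg h2 _)]; exact clip_le _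
  calc ξ * C ≤ ξ * ν.real {x | 2 * ξ ≤ ‖(x * Y).trace‖} := mul_le_mul_of_nonneg_left hC hξ
    _ = ∫ x, Set.indicator {x | 2 * ξ ≤ ‖(x * Y).trace‖} (fun _ => ξ) x ∂ν := by
      rw [integral_indicator_const _ hS, smul_eq_mul, mul_comm]
    _ ≤ _ := by
      refine integral_mono ((integrable_const ξ).indicator hS) hi fun x => ?_
      by_cases hx : x ∈ {x : Matrix n n 𝕜 | 2 * ξ ≤ ‖(x * Y).trace‖}
      · rw [Set.indicator_of_mem hx]; exact le_clip hξ hx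
      · rw [Set.indicator_of_notMem hx]; exact clip_nonneg h2 _

variable [DecidableEq n]

lemma continuous_specNorm : Continuous (specNorm : Matrix n n 𝕜 → ℝ) := by
  refine continuous_norm.comp ?_
  exact LinearMap.continuous_of_finiteDimensional
    (Matrix.toEuclideanCLM (n := n) (𝕜 := 𝕜)).toAlgEquiv.toLinearMap

lemma specNorm_smul (c : ℝ) (X : Matrix n n 𝕜) : specNorm (c • X) = |c| * specNorm X := by
  have : c • X = (c : 𝕜) • X := by
    ext i j
    simp [RCLike.real_smul_eq_coe_mul]
  rw [this, specNorm, map_smul, norm_smul, RCLike.norm_ofReal, specNorm]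

/-- Pointwise comparison of the Rademacher complexity of the clipped process with the spectral
norm of the signed sum. -/
lemma sum_ciSup_clip_le {ι : Type*} [Nonempty ι] (Y : ι → Matrix n n 𝕜) {K b : ℝ} (hb : 0 ≤ b)
    (hF : ∀ i, frobNorm (Y i) = 1) (hK : ∀ i, nuclearNorm (Y i) ≤ K)
    (x : Fin m → Matrix n n 𝕜) :
    ∑ ε : Fin m → ℤˣ, (⨆ i, (0 + ∑ k, ((ε k : ℤ) : ℝ) * (2 * clip b (x k * Y i).trace))) ≤
      ∑ ε : Fin m → ℤˣ, 2 * K * specNorm (∑ k, ((ε k : ℤ) : ℝ) • x k) := by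
  set B := max b (∑ k, frobNorm (x k)) with hB
  have hbB : b ≤ B := le_max_left _ _
  have hz : ∀ k i, ‖(x k * Y i).trace‖ ≤ B := by
    intro k i
    refine (norm_trace_mul_le_frobNorm _ _).trans ?_
    rw [hF, mul_one]
    exact (Finset.single_le_sum (f := fun k => frobNorm (x k)) (fun k _ => frobNorm_nonneg _)
      (Finset.mem_univ k)).trans (le_max_right _ _)
  have hclip : ∀ s : ℝ, |min |s| b| ≤ b := fun s => by
    rw [abs_of_nonneg (le_min (abs_nonneg s) hb)]; exact min_le_right _ _
  -- The contraction principle is real-valued, so it is applied to real and imaginary parts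
  -- separately. Each costs one `K`, whence the factor 2.
  have main : ∀ p : 𝕜 → ℝ, (∀ z, |p z| ≤ ‖z‖) →
      (∀ (ε : Fin m → ℤˣ) (z : Fin m → 𝕜),
        p (∑ k, ((ε k : ℤ) : ℝ) • z k) = ∑ k, ((ε k : ℤ) : ℝ) * p (z k)) →
      ∑ ε : Fin m → ℤˣ, (⨆ i, (0 + ∑ k, ((ε k : ℤ) : ℝ) * min |p (x k * Y i).trace| b)) ≤
        ∑ ε : Fin m → ℤˣ, K * specNorm (∑ k, ((ε k : ℤ) : ℝ) • x k) := by
    intro p hp hlin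
    refine (rademacher_contraction m (fun _ => 0)
      (fun k i => min |p (x k * Y i).trace| b) (fun k i => p (x k * Y i).trace) (B := B)
      (fun i => by rw [abs_zero]; exact hb.trans hbB) (fun k i => (hclip _).trans hbB)
      (fun k i => (hp _).trans (hz k i))
      (fun k i j => abs_clip_sub_clip_le _ _ _)).trans (Finset.sum_le_sum fun ε _ => ?_)
    refine ciSup_le fun i => ?_
    rw [zero_add, ← hlin, ← trace_signed_sum_mul]
    refine (le_abs_self _).trans ((hp _).trans ((norm_trace_mul_le _ _).trans ?_))
    rw [mul_comm]
    exact mul_le_mul_of_nonneg_right (hK i) (specNorm_nonneg _)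
  have hre := main (fun z => RCLike.re z) RCLike.abs_re_le_norm
    fun ε z => by simp [RCLike.smul_re]
  have him := main (fun z => RCLike.im z) RCLike.abs_im_le_norm
    fun ε z => by simp [RCLike.smul_im]
  have hsplit : ∀ ε : Fin m → ℤˣ,
      (⨆ i, (0 + ∑ k, ((ε k : ℤ) : ℝ) * (2 * clip b (x k * Y i).trace))) ≤
      (⨆ i, (0 + ∑ k, ((ε k : ℤ) : ℝ) * min |RCLike.re (x k * Y i).trace| b)) +
      ⨆ i, (0 + ∑ k, ((ε k : ℤ) : ℝ) * min |RCLike.im (x k * Y i).trace| b) := by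
    intro ε
    refine ciSup_le fun i => ?_
    have h1 := le_ciSup_of_abs_le (B := m * b)
      (f := fun i => 0 + ∑ k, ((ε k : ℤ) : ℝ) * min |RCLike.re (x k * Y i).trace| b)
      (fun i => by rw [zero_add]; exact abs_sum_signs_le ε fun k => hclip _) i
    have h2 := le_ciSup_of_abs_le (B := m * b)
      (f := fun i => 0 + ∑ k, ((ε k : ℤ) : ℝ) * min |RCLike.im (x k * Y i).trace| b)
      (fun i => by rw [zero_add]; exact abs_sum_signs_le ε fun k => hclip _) i
    refine le_trans (le_of_eq ?_) (add_le_add h1 h2)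
    simp only [zero_add, ← Finset.sum_add_distrib, clip]
    exact Finset.sum_congr rfl fun k _ => by ring
  refine (Finset.sum_le_sum fun ε _ => hsplit ε).trans ?_
  rw [Finset.sum_add_distrib]
  refine (add_le_add hre him).trans (le_of_eq ?_)
  rw [← Finset.sum_add_distrib]
  exact Finset.sum_congr rfl fun ε _ => by ring

variable {Ω : Type*} [MeasurableSpace Ω] {P : Measure Ω} [IsProbabilityMeasure P]
  {ν : Measure (Matrix n n 𝕜)} [IsProbabilityMeasure ν] {A : Fin m → Ω → Matrix n n 𝕜}

lemma measurable_specNorm_signed_sum (ε : Fin m → ℤˣ) :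
    Measurable fun x : Fin m → Matrix n n 𝕜 => specNorm (∑ k, ((ε k : ℤ) : ℝ) • x k) := by
  refine Continuous.measurable (continuous_specNorm.comp ?_)
  fun_prop

/-- The Rademacher complexity of the clipped process is controlled by the expected spectral norm
of the signed sum. -/
lemma sum_integral_ciSup_clip_le (hA : IsIIDSample P ν A) {ι : Type*} [Nonempty ι] [Countable ι]
    (Y : ι → Matrix n n 𝕜) {K b w : ℝ} (hb : 0 ≤ b) (hK0 : 0 ≤ K) (hw : 0 ≤ w)
    (hF : ∀ i, frobNorm (Y i) = 1) (hK : ∀ i, nuclearNorm (Y i) ≤ K)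
    (hm : 0 < m) (hA2 : expSpecNorm P A ≤ ENNReal.ofReal w) :
    ∑ ε : Fin m → ℤˣ, ∫ x : Fin m → Matrix n n 𝕜,
      (⨆ i, (0 + ∑ k, ((ε k : ℤ) : ℝ) * (2 * clip b (x k * Y i).trace)))
        ∂Measure.pi (fun _ => ν) ≤ 2 ^ m * (2 * K * √m * w) := by
  have hmeas : ∀ ε : Fin m → ℤˣ, Measurable fun x : Fin m → Matrix n n 𝕜 =>
      ⨆ i, (0 + ∑ k, ((ε k : ℤ) : ℝ) * (2 * clip b (x k * Y i).trace)) := by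
    intro ε
    refine Measurable.iSup fun i => (Finset.measurable_sum _ fun k _ => ?_).const_add 0
    exact (((measurable_clip_trace b (Y i)).comp (measurable_pi_apply k)).const_mul 2).const_mul _
  have hint : ∀ ε : Fin m → ℤˣ, Integrable (fun x : Fin m → Matrix n n 𝕜 =>
      ⨆ i, (0 + ∑ k, ((ε k : ℤ) : ℝ) * (2 * clip b (x k * Y i).trace)))
        (Measure.pi fun _ => ν) := by
    intro ε
    refine integrable_of_abs_le (hmeas ε) (B := m * (2 * b)) fun x => abs_ciSup_le fun i => ?_
    rw [zero_add]
    refine abs_sum_signs_le ε fun k => ?_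
    rw [abs_of_nonneg (mul_nonneg zero_le_two (clip_nonneg hb _))]
    linarith [clip_le (b := b) (x k * Y i).trace]
  have hAm : Measurable fun ω k => A k ω := measurable_pi_lambda _ hA.measurable
  have hsm : 0 < √(m : ℝ) := Real.sqrt_pos.2 (by exact_mod_cast hm)
  rw [← integral_finsetSum _ fun ε _ => hint ε]
  refine integral_le_of_lintegral_le (integrable_finsetSum _ fun ε _ => hint ε)
    (g := fun x => ∑ ε : Fin m → ℤˣ, 2 * K * specNorm (∑ k, ((ε k : ℤ) : ℝ) • x k)) ?_ ?_ ?_ ?_ ?_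
  · exact Finset.measurable_sum _ fun ε _ => (measurable_specNorm_signed_sum ε).const_mul _
  · exact fun x => Finset.sum_nonneg fun ε _ => mul_nonneg (by positivity) (specNorm_nonneg _)
  · exact fun x => sum_ciSup_clip_le Y hb hF hK x
  · positivity
  · have e1 : ∀ x : Fin m → Matrix n n 𝕜, ENNReal.ofReal
        (∑ ε : Fin m → ℤˣ, 2 * K * specNorm (∑ k, ((ε k : ℤ) : ℝ) • x k)) =
        ∑ ε : Fin m → ℤˣ, ENNReal.ofReal (2 * K * √m) * ENNReal.ofReal
          (specNorm ((1 / √m : ℝ) • ∑ k, ((ε k : ℤ) : ℝ) • x k)) := by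
      intro x
      rw [ENNReal.ofReal_sum_of_nonneg fun ε _ => mul_nonneg (by positivity) (specNorm_nonneg _)]
      refine Finset.sum_congr rfl fun ε _ => ?_
      rw [← ENNReal.ofReal_mul (by positivity), specNorm_smul, abs_of_pos (by positivity)]
      congr 1
      field_simp
    have hme : ∀ ε : Fin m → ℤˣ, Measurable fun x : Fin m → Matrix n n 𝕜 =>
        ENNReal.ofReal (specNorm ((1 / √m : ℝ) • ∑ k, ((ε k : ℤ) : ℝ) • x k)) := by
      intro ε
      simp only [specNorm_smul]
      exact ((measurable_specNorm_signed_sum ε).const_mul _).ennreal_ofReal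
    simp only [e1]
    rw [lintegral_finsetSum _ fun ε _ => (hme ε).const_mul _]
    simp only [lintegral_const_mul _ (hme _), ← hA.map_eq, lintegral_map (hme _) hAm]
    rw [← Finset.mul_sum]
    have e2 : ∑ ε : Fin m → ℤˣ, ∫⁻ ω, ENNReal.ofReal
        (specNorm ((1 / √m : ℝ) • ∑ k, ((ε k : ℤ) : ℝ) • A k ω)) ∂P =
        2 ^ m * expSpecNorm P A := by
      rw [expSpecNorm, ← mul_assoc, ENNReal.mul_inv_cancel (by simp) (by simp), one_mul]
    rw [e2]
    calc _ ≤ ENNReal.ofReal (2 * K * √m) * (2 ^ m * ENNReal.ofReal w) := by gcongr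
      _ = _ := by
        rw [show (2 : ℝ≥0∞) ^ m = ENNReal.ofReal (2 ^ m) by
          rw [ENNReal.ofReal_pow zero_le_two]; simp, ← ENNReal.ofReal_mul (by positivity),
          ← ENNReal.ofReal_mul (by positivity)]
        congr 1; ring

/-- Lower bound for the minimum conic singular value over the nuclear norm descent cones. -/
theorem MeetsCriteria.withProb_le_minConicSV {ξ C₁ C₂ : ℝ} (hξ : 0 < ξ) (hC₂ : 0 < C₂)
    (hC : 2 * (1 + √2) * C₂ < ξ * C₁) {L : Submodule ℝ (Matrix n n 𝕜)} {r : ℕ} (hr : 1 ≤ r)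
    (hm : 0 < m) (h : MeetsCriteria P ν A L r ξ C₁ C₂) :
    WithProb P (1 - Real.exp (-((ξ * C₁ - 2 * (1 + √2) * C₂) ^ 2 / (32 * ξ ^ 2) * m))) fun ω =>
      ENNReal.ofReal (2 * ((ξ * C₁ - 2 * (1 + √2) * C₂) / 4) * √m) ≤
        minConicSV (fun i => A i ω) (coneUnion nuclearNorm L (rankLE r)) := by
  set Δ := ξ * C₁ - 2 * (1 + √2) * C₂ with hΔ
  have hΔ0 : 0 < Δ := sub_pos.2 hC
  have hm' : (0 : ℝ) < m := by exact_mod_cast hm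
  have hr' : (0 : ℝ) < r := by exact_mod_cast hr
  set E : Set (Matrix n n 𝕜) := {Y ∈ coneUnion nuclearNorm L (rankLE r) | frobNorm Y = 1} with hE
  -- it suffices to consider the unit vectors of the cone
  have hscale : ∀ x : Fin m → Matrix n n 𝕜,
      (∀ Y ∈ E, m * (Δ / 2) ≤ ∑ k, ‖(x k * Y).trace‖) →
      ENNReal.ofReal (2 * (Δ / 4) * √m) ≤
        minConicSV x (coneUnion nuclearNorm L (rankLE r)) := by
    intro x hx
    refine le_minConicSV_iff.2 fun Y hY hY0 => ?_
    have hF : 0 < frobNorm Y := (frobNorm_nonneg Y).lt_of_ne' (frobNorm_eq_zero.not.2 hY0)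
    have h1 := (hx ((frobNorm Y)⁻¹ • Y) ⟨smul_mem_coneUnion hY (inv_pos.2 hF), by
      rw [frobNorm_smul, abs_of_pos (inv_pos.2 hF), inv_mul_cancel₀ hF.ne']⟩).trans
      (sum_norm_trace_le _ _)
    rw [measurementMap_smul, norm_smul, Real.norm_eq_abs, abs_of_pos (inv_pos.2 hF)] at h1
    have hs : 0 < √(m : ℝ) := Real.sqrt_pos.2 hm'
    refine le_of_mul_le_mul_left ?_ (mul_pos hs (inv_pos.2 hF))
    rw [mul_assoc √(m : ℝ)]
    refine le_trans (le_of_eq ?_) (h1.trans (le_of_eq (by ring)))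
    field_simp
    rw [Real.sq_sqrt hm'.le]
    ring
  rcases E.eq_empty_or_nonempty with hE0 | hE0
  · refine ⟨Set.univ, MeasurableSet.univ, ?_, fun ω _ => hscale _ ?_⟩
    · rw [measure_univ]
      exact ENNReal.ofReal_le_one.2 (sub_le_self _ (Real.exp_nonneg _))
    · rw [hE0]; simp
  have : Nonempty E := hE0.to_subtype
  -- A countable dense family keeps the suprema measurable; the final inequality is closed in `Y`
  -- and so extends to all of `E`.
  set Y : ℕ → Matrix n n 𝕜 := fun j => (TopologicalSpace.denseSeq E j : Matrix n n 𝕜) with hY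
  have hYE : ∀ j, Y j ∈ E := fun j => (TopologicalSpace.denseSeq E j).2
  have hYF : ∀ j, frobNorm (Y j) = 1 := fun j => (hYE j).2
  have hYK : ∀ j, nuclearNorm (Y j) ≤ (1 + √2) * √r := by
    intro j
    obtain ⟨⟨-, X, -, hXr, -, hYX⟩, hF⟩ := hYE j
    have := nuclearNorm_le_of_mem_descentCone hXr hYX
    rwa [hF, mul_one] at this
  have hW := sum_integral_ciSup_clip_le h.iid Y (b := 2 * ξ) (K := (1 + √2) * √r)
    (w := C₂ * √(m / r)) (by positivity) (by positivity) (by positivity) hYF hYK hm h.width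
  have hWeq : 2 * ((1 + √2) * √r) * √m * (C₂ * √(m / r)) = 2 * (1 + √2) * C₂ * m := by
    rw [Real.sqrt_div hm'.le]
    have : √(r : ℝ) ≠ 0 := (Real.sqrt_pos.2 hr').ne'
    field_simp
    rw [Real.sq_sqrt hm'.le]
  rw [hWeq] at hW
  -- Half of the gap mΔ is given to the fluctuation. With increments bounded by 2ξ the exponent is
  -- (mΔ/2)²/(2m(2ξ)²) = mΔ²/(32ξ²).
  obtain ⟨G, hG, hPG, hGb⟩ := exists_uniform_lower_bound ν m
    (φ := fun j x => clip (2 * ξ) (x * Y j).trace) (fun j => measurable_clip_trace _ _)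
    (b := ⟨2 * ξ, by positivity⟩) (fun j x => clip_nonneg (by positivity) _)
    (fun j x => clip_le _) (s := m * (Δ / 2)) (by positivity) hW
  have hAm : Measurable fun ω k => A k ω := measurable_pi_lambda _ h.iid.measurable
  refine ⟨(fun ω k => A k ω) ⁻¹' G, hAm hG, ?_, fun ω hω => hscale _ ?_⟩
  · rw [← Measure.map_apply hAm hG, h.iid.map_eq]
    refine le_trans (le_of_eq ?_) hPG
    congr 3
    change _ = -(m * (Δ / 2)) ^ 2 / (2 * (m * (2 * ξ) ^ 2))
    field_simp
    ring
  · have hclosed : IsClosed {Z : E | m * (Δ / 2) ≤ ∑ k, ‖(A k ω * (Z : Matrix n n 𝕜)).trace‖} :=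
      isClosed_le continuous_const (by fun_prop)
    intro Z hZ
    refine (TopologicalSpace.denseRange_denseSeq E).induction_on
      (p := fun Z : E => m * (Δ / 2) ≤ ∑ k, ‖(A k ω * (Z : Matrix n n 𝕜)).trace‖)
      ⟨Z, hZ⟩ hclosed fun j => ?_
    have hsb : ξ * C₁ ≤ ∫ x, clip (2 * ξ) (x * Y j).trace ∂ν :=
      le_integral_clip hξ.le (h.small_ball.trans (iInf₂_le (Y j) (hYE j)))
    have h1 := hGb _ hω j
    have h2 : ∑ k, clip (2 * ξ) (A k ω * Y j).trace ≤ ∑ k, ‖(A k ω * Y j).trace‖ :=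
      Finset.sum_le_sum fun k _ => clip_le_norm _
    refine le_trans ?_ (h1.trans h2)
    have h3 := mul_le_mul_of_nonneg_left hsb hm'.le
    rw [hΔ]
    linarith

end Ensembles

/-! ### Events and the final assembly -/

section Events

variable {Ω : Type*} [MeasurableSpace Ω] {P : Measure Ω}

lemma WithProb.mono {p : ℝ} {E E' : Ω → Prop} (h : WithProb P p E) (hE : ∀ ω, E ω → E' ω) :
    WithProb P p E' := by
  obtain ⟨G, hG, hp, hGE⟩ := h
  exact ⟨G, hG, hp, fun ω hω => hE ω (hGE ω hω)⟩

lemma withProb_of_nonpos {p : ℝ} (hp : p ≤ 0) (E : Ω → Prop) : WithProb P p E :=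
  ⟨∅, MeasurableSet.empty, by simp [ENNReal.ofReal_of_nonpos hp], fun _ h => h.elim⟩

end Events

end SquareRecovery

end


theorem mainTheorem10 (ξ C₁ C₂ : ℝ) (hξ : 0 < ξ) (hC₁ : 0 < C₁) (hC₂ : 0 < C₂)
    (hC : 2 * (1 + √2) * C₂ < ξ * C₁) :
    ∃ C₃ C₄ : ℝ, 0 < C₃ ∧ 0 < C₄ ∧
      -- uniform recovery by nuclear norm minimization
      (∀ (𝕜 : Type*) [RCLike 𝕜] (n : Type*) [Fintype n] [DecidableEq n]
        (Ω : Type*) [MeasurableSpace Ω] (P : Measure Ω) [IsProbabilityMeasure P]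
        (ν : Measure (Matrix n n 𝕜)) [IsProbabilityMeasure ν]
        (m r : ℕ) (A : Fin m → Ω → Matrix n n 𝕜) (L : Submodule ℝ (Matrix n n 𝕜)),
        1 ≤ r → r ≤ Fintype.card n →
        SquareRecovery.MeetsCriteria P ν A L r ξ C₁ C₂ →
        SquareRecovery.WithProb P (1 - Real.exp (-(C₄ * m))) fun ω =>
          SquareRecovery.StablyRecovers SquareRecovery.nuclearNorm L
            (SquareRecovery.rankLE r) (fun i => A i ω) C₃) ∧
      -- uniform recovery by square norm minimization, with constants at least as good
      (∃ C₃' C₄' : ℝ, C₃ ≤ C₃' ∧ C₄ ≤ C₄' ∧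
        ∀ (𝕜 : Type*) [RCLike 𝕜] (w v : Type*) [Fintype w] [DecidableEq w]
          [Fintype v] [DecidableEq v]
          (Ω : Type*) [MeasurableSpace Ω] (P : Measure Ω) [IsProbabilityMeasure P]
          (ν : Measure (Matrix (w × v) (w × v) 𝕜)) [IsProbabilityMeasure ν]
          (m r : ℕ) (A : Fin m → Ω → Matrix (w × v) (w × v) 𝕜)
          (L : Submodule ℝ (Matrix (w × v) (w × v) 𝕜)),
          1 ≤ r → r ≤ Fintype.card (w × v) →
          SquareRecovery.MeetsCriteria P ν A L r ξ C₁ C₂ →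
          SquareRecovery.WithProb P (1 - Real.exp (-(C₄' * m))) fun ω =>
            SquareRecovery.StablyRecovers SquareRecovery.squareNorm L
              (SquareRecovery.rankLEExtremal r) (fun i => A i ω) C₃') ∧
      -- whatever constants the nuclear norm descent cones certify are valid for the square norm
      (∀ (𝕜 : Type*) [RCLike 𝕜] (w v : Type*) [Fintype w] [DecidableEq w]
        [Fintype v] [DecidableEq v]
        (Ω : Type*) [MeasurableSpace Ω] (P : Measure Ω) [IsProbabilityMeasure P]
        (m r : ℕ) (A : Fin m → Ω → Matrix (w × v) (w × v) 𝕜)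
        (L : Submodule ℝ (Matrix (w × v) (w × v) 𝕜)) (c₃ c₄ : ℝ),
        1 ≤ r → r ≤ Fintype.card (w × v) → 0 < c₃ → 0 < c₄ →
        (SquareRecovery.WithProb P (1 - Real.exp (-(c₄ * m))) fun ω =>
          ENNReal.ofReal (2 * c₃ * √m) ≤ SquareRecovery.minConicSV (fun i => A i ω)
            (SquareRecovery.coneUnion SquareRecovery.nuclearNorm L
              (SquareRecovery.rankLE r))) →
        SquareRecovery.WithProb P (1 - Real.exp (-(c₄ * m))) fun ω =>
          ENNReal.ofReal (2 * c₃ * √m) ≤ SquareRecovery.minConicSV (fun i => A i ω)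
            (SquareRecovery.coneUnion SquareRecovery.squareNorm L
              (SquareRecovery.rankLEExtremal r)) ∧
          SquareRecovery.StablyRecovers SquareRecovery.nuclearNorm L
            (SquareRecovery.rankLE r) (fun i => A i ω) c₃ ∧
          SquareRecovery.StablyRecovers SquareRecovery.squareNorm L
            (SquareRecovery.rankLEExtremal r) (fun i => A i ω) c₃) := by
  have hΔ : 0 < ξ * C₁ - 2 * (1 + √2) * C₂ := sub_pos.2 hC
  -- The same pair of constants serves both norms, since the event used for the square norm is the
  -- one on which the nuclear norm cones are controlled.
  refine ⟨(ξ * C₁ - 2 * (1 + √2) * C₂) / 4, (ξ * C₁ - 2 * (1 + √2) * C₂) ^ 2 / (32 * ξ ^ 2),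
    by positivity, by positivity, ?_, ⟨_, _, le_rfl, le_rfl, ?_⟩, ?_⟩
  · intro 𝕜 _ n _ _ Ω _ P _ ν _ m r A L hr _ h
    -- Without measurements the required probability is 1 - exp 0 = 0 and the empty event will do.
    -- Otherwise √m > 0, as the recovery bound needs.
    rcases Nat.eq_zero_or_pos m with rfl | hm
    · exact SquareRecovery.withProb_of_nonpos (by simp) _
    exact (h.withProb_le_minConicSV hξ hC₂ hC hr hm).mono fun ω hω =>
      SquareRecovery.nuclearNorm_stablyRecovers (by positivity) hm hω
  · intro 𝕜 _ w v _ _ _ _ Ω _ P _ ν _ m r A L hr _ h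
    rcases Nat.eq_zero_or_pos m with rfl | hm
    · exact SquareRecovery.withProb_of_nonpos (by simp) _
    exact (h.withProb_le_minConicSV hξ hC₂ hC hr hm).mono fun ω hω =>
      SquareRecovery.squareNorm_stablyRecovers (by positivity) hm hω
  · intro 𝕜 _ w v _ _ _ _ Ω _ P _ m r A L c₃ c₄ _ _ hc₃ _ h
    rcases Nat.eq_zero_or_pos m with rfl | hm
    · exact SquareRecovery.withProb_of_nonpos (by simp) _
    exact h.mono fun ω hω =>
      ⟨hω.trans (SquareRecovery.minConicSV_anti _
        (SquareRecovery.coneUnion_squareNorm_subset L r)),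
      SquareRecovery.nuclearNorm_stablyRecovers hc₃ hm hω,
      SquareRecovery.squareNorm_stablyRecovers hc₃ hm hω⟩
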